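/- Notation. $L^2(\mathbb R)$ is the space of square integrable functions $\mathbb R\to\mathbb C$ with inner product $\langle f_1,f_2\rangle=\int f_1\overline{f_2}$, and $\hat f(\xi)=(2\pi)^{-1/2}\int_{-\infty}^{\infty}e^{-ix\xi}f(x)\,dx$ is the Fourier transform on $L^2(\mathbb R)$. Assumptions. Let $\varphi\in L^2(\mathbb R)$. Let $w(\xi)$, $\xi>0$, be a positive, monotonically increasing weight such that $w(\xi)\ge c\,\xi^{1+\epsilon}$ for all $\xi\ge 1$, with some $c>0$, $\epsilon>0$, and $$M_w(\varphi)=\int_{-\infty}^{\infty}w(|\xi|)\,|\hat\varphi(\xi)|^2\,d\xi<\infty .$$ Let $\mathbf\Lambda$ be a non-empty set of positive reals (the admissible sampling intervals) such that for every $\lambda\in\mathbf\Lambda$ the family $\{\varphi(\cdot-n\lambda)\}_{n\in\mathbb Z}$ is a Riesz basis of its closed linear span in $L^2(\mathbb R)$. Definitions. For $f\in L^2(\mathbb R)$ put $(P_\varphi f)(x)=\int_{-\infty}^{\infty}f(y)\overline{\varphi(y-x)}\,dy$, $x\in\mathbb R$. Let $\mathcal P_\varphi=\{P_\varphi f: f\in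 L^2(\mathbb R)\}$ with inner product and norm $$\langle g_1,g_2\rangle_\varphi=\frac1{2\pi}\int_{\{\hat\varphi\ne0\}}\hat g_1(\xi)\overline{\hat g_2(\xi)}\,|\hat\varphi(\xi)|^{-2}\,d\xi,\qquad \|g\|_\varphi=\sqrt{\langle g,g\rangle_\varphi},$$ and let $\Phi=P_\varphi\varphi$. For $\lambda\in\mathbf\Lambda$ let $\mathcal R_\lambda(\varphi)$ be the closed linear span of $\{\Phi(\cdot-n\lambda)\}_{n\in\mathbb Z}$ in $\mathcal P_\varphi$, and let $\Phi_{\mathrm{int}}$ be the function with Fourier transform $$\hat\Phi_{\mathrm{int}}(\xi)=\frac{\hat\Phi(\xi)}{\frac{2\pi/\lambda}{\sqrt{2\pi}}\sum_{n\in\mathbb Z}\hat\Phi(\xi+2\pi n/\lambda)},$$ that is, $\Phi_{\mathrm{int}}(x)=(2\pi)^{-1/2}\int_{-\infty}^\infty e^{ix\xi}\,\hat\Phi_{\mathrm{int}}(\xi)\,d\xi$. Theorem 3 (Generalized Sampling Theorem). Under these assumptions, for every $\lambda\in\mathbf\Lambda$, the objects above are well defined: $\mathcal P_\varphi\subseteq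 L^2(\mathbb R)$ and the integral defining $\|g\|_\varphi^2$ converges for every $g\in\mathcal P_\varphi$; the series in the denominator converges and the denominator is non-zero for almost every $\xi$; the quotient defining $\hat\Phi_{\mathrm{int}}$ is integrable and is the Fourier transform of $\Phi_{\mathrm{int}}$; and $\Phi_{\mathrm{int}}\in\mathcal R_\lambda(\varphi)\subseteq\mathcal P_\varphi$. For every $g\in\mathcal P_\varphi$ the series $$\tilde g(x)=\sum_{n=-\infty}^{\infty}g(n\lambda)\,\Phi_{\mathrm{int}}(x-n\lambda)$$ converges (unconditionally) in the norm of $\mathcal P_\varphi$ and uniformly on $\mathbb R$ to a function $\tilde g\in\mathcal R_\lambda(\varphi)$ with $\tilde g(n\lambda)=g(n\lambda)$ for all $n\in\mathbb Z$. Moreover $\sum_{n\ge1}1/w((2n-1)\pi/\lambda)<\infty$ and, for all $x\in\mathbb R$, $$|g(x)-\tilde g(x)|^2\le 8\,M_w(\varphi)\left(\sum_{n=1}^{\infty}\frac{1}{w((2n-1)\pi/\lambda)}\right)\|g\|_\varphi^2 .$$ In particular, if $g\ne0$, then $\|g\|_\varphi>0$ and the relative error satisfies $$\left(\frac{|g(x)-\tilde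 g(x)|}{\|g\|_\varphi}\right)^2\le 8\,M_w(\varphi)\sum_{n=1}^{\infty}\frac{1}{w((2n-1)\pi/\lambda)}\qquad\text{for all }x\in\mathbb R .$$ -/

import Mathlib

open MeasureTheory Filter Topology
open scoped FourierTransform ComplexConjugate

noncomputable section

namespace GenSampling

/-- The Hilbert space of finite-energy signals `ℝ → ℂ`. -/
abbrev L2R : Type := Lp ℂ 2 (volume : Measure ℝ)

/-- The Fourier transform of a function `g ∈ L²(ℝ)` in the angular-frequency normalization
`ĝ(ξ) = (2π)^{-1/2} ∫ e^{-ixξ} g(x) dx` (extended from `L¹ ∩ L²` by Plancherel). It is obtained by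
rescaling Mathlib's `L²` transform, whose kernel is `e^{-2πixξ}`. Like every element of `L²` it is
determined up to a null set. The value for `g ∉ L²(ℝ)` is irrelevant. -/
def fourierL2 (g : ℝ → ℂ) (ξ : ℝ) : ℂ :=
  open Classical in
  if hg : MemLp g 2 (volume : Measure ℝ) then
    (((Real.sqrt (2 * Real.pi))⁻¹ : ℝ) : ℂ) * (𝓕 (hg.toLp g) : L2R) (ξ / (2 * Real.pi))
  else 0

/-- The translate `φ(· - t)` of `φ ∈ L²(ℝ)`. -/
def translate (t : ℝ) (φ : L2R) : L2R :=
  Lp.compMeasurePreserving (fun x : ℝ => x - t) (measurePreserving_sub_right volume t) φ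

/-- The family `e` is a Riesz basis of its closed linear span. -/
def IsRieszBasisOfSpan {ι H : Type*} [NormedAddCommGroup H] [NormedSpace ℂ H] (e : ι → H) : Prop :=
  ∃ A B : ℝ, 0 < A ∧ 0 < B ∧ ∀ c : ι →₀ ℂ,
    A * ∑ i ∈ c.support, ‖c i‖ ^ 2 ≤ ‖∑ i ∈ c.support, c i • e i‖ ^ 2 ∧
      ‖∑ i ∈ c.support, c i • e i‖ ^ 2 ≤ B * ∑ i ∈ c.support, ‖c i‖ ^ 2

/-- The generalized moment `M_w(φ) = ∫ w(|ξ|) |φ̂(ξ)|² dξ`. -/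
def moment (w : ℝ → ℝ) (φ : L2R) : ℝ :=
  ∫ ξ : ℝ, w |ξ| * ‖fourierL2 φ ξ‖ ^ 2

/-- The standing assumptions on the prefilter function `φ ∈ L²(ℝ)`, the weight `w` and the set
`S` of admissible sampling intervals. -/
structure IsPrefilter (φ : L2R) (w : ℝ → ℝ) (S : Set ℝ) : Prop where
  weight_pos : ∀ ξ : ℝ, 0 < ξ → 0 < w ξ
  weight_mono : MonotoneOn w (Set.Ioi 0)
  weight_growth : ∃ c ε : ℝ, 0 < c ∧ 0 < ε ∧ ∀ ξ : ℝ, 1 ≤ ξ → c * ξ ^ (1 + ε) ≤ w ξ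
  moment_finite : Integrable (fun ξ : ℝ => w |ξ| * ‖fourierL2 φ ξ‖ ^ 2)
  intervals_nonempty : S.Nonempty
  intervals_pos : ∀ lam ∈ S, 0 < lam
  riesz : ∀ lam ∈ S, IsRieszBasisOfSpan (fun n : ℤ => translate (n * lam) φ)

/-- The prefilter `(P_φ f)(x) = ∫ f(y) conj φ(y - x) dy`, as an everywhere defined function. -/
def prefilter (φ f : L2R) (x : ℝ) : ℂ :=
  ∫ y : ℝ, f y * conj (φ (y - x))

/-- The localization space, i.e. the range of the prefilter on `L²(ℝ)`. -/
def locSpace (φ : L2R) : Set (ℝ → ℂ) := Set.range (prefilter φ)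

/-- The inner product `(2π)⁻¹ ∫ ĝ₁ conj ĝ₂ |φ̂|⁻²` over the set where `φ̂ ≠ 0`. -/
def locInner (φ : L2R) (g₁ g₂ : ℝ → ℂ) : ℂ :=
  ((2 * Real.pi : ℝ) : ℂ)⁻¹ * ∫ ξ in Function.support (fourierL2 φ),
    fourierL2 g₁ ξ * conj (fourierL2 g₂ ξ) * (((‖fourierL2 φ ξ‖ ^ 2)⁻¹ : ℝ) : ℂ)

/-- The norm of the localization space. -/
def locNorm (φ : L2R) (g : ℝ → ℂ) : ℝ := Real.sqrt (locInner φ g g).re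

/-- `Φ = P_φ φ`, the autocorrelation function of `φ`. -/
def autocorr (φ : L2R) : ℝ → ℂ := prefilter φ φ

/-- The reconstruction subspace: the closed linear span, inside the localization space with its
norm, of the translates `Φ(· - nλ)`, `n ∈ ℤ`. -/
def recSpace (φ : L2R) (lam : ℝ) : Set (ℝ → ℂ) :=
  {g | g ∈ locSpace φ ∧ ∀ ε : ℝ, 0 < ε →
    ∃ v ∈ Submodule.span ℂ (Set.range fun (n : ℤ) (x : ℝ) => autocorr φ (x - n * lam)),
      locNorm φ (g - v) < ε}

/-- The denominator `(Λ / √(2π)) ∑ₙ Φ̂(ξ + nΛ)` with `Λ = 2π / λ`. -/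
def interpDenom (φ : L2R) (lam ξ : ℝ) : ℂ :=
  ((2 * Real.pi / lam / Real.sqrt (2 * Real.pi) : ℝ) : ℂ) *
    ∑' n : ℤ, fourierL2 (autocorr φ) (ξ + n * (2 * Real.pi / lam))

/-- The Fourier transform `Φ̂(ξ) / ((Λ / √(2π)) ∑ₙ Φ̂(ξ + nΛ))` prescribed for `Φ_int`. -/
def interpHat (φ : L2R) (lam ξ : ℝ) : ℂ :=
  fourierL2 (autocorr φ) ξ / interpDenom φ lam ξ

/-- The interpolating function `Φ_int`, by Fourier inversion:
`Φ_int(x) = (2π)^{-1/2} ∫ e^{ixξ} Φ̂_int(ξ) dξ`. -/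
def interp (φ : L2R) (lam x : ℝ) : ℂ :=
  (((Real.sqrt (2 * Real.pi))⁻¹ : ℝ) : ℂ) *
    ∫ ξ : ℝ, Complex.exp (Complex.I * ((x * ξ : ℝ) : ℂ)) * interpHat φ lam ξ

/-- The finite part of the sampling series `∑ₙ g(nλ) Φ_int(x - nλ)` over the index set `s`. -/
def partialSeries (φ : L2R) (lam : ℝ) (g : ℝ → ℂ) (s : Finset ℤ) (x : ℝ) : ℂ :=
  ∑ n ∈ s, g (n * lam) * interp φ lam (x - n * lam)

end GenSampling

end

/-! Since `(P_φ f)(x) = ⟨f, φ(· - x)⟩`, the theorem becomes Hilbert space geometry in `L²`.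
Plancherel turns `‖P_φ f‖_φ` into the energy of `f` on the spectrum of `φ`, so `P_φ` is a
contraction onto its range and every `g` has a preimage `f` of the same norm
(`exists_prefilter_eq_norm_eq`). Let `V` be the closed span of the translates `φ(· - nλ)`. The
reconstruction is the image under `P_φ` of the orthogonal projection of `f` onto `V`. The samples
`g(nλ)` are pairings of `f` with elements of `V`, so projecting does not change them.

The series is the expansion of that projection along the biorthogonal system of the Riesz basis
(`IsRieszBasisOfSpan.hasSum_starProjection`). Pushing `|𝓕 φ|²` forward to a circle turns the Riesz
condition into two-sided bounds on its periodization (`exists_periodization_bounds`). Dividing by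
the periodization gives a dual generator `ψ` with biorthogonal translates
(`inner_translate_dualGenerator`), and `Φ_int = P_φ ψ` (`interp_eq_prefilter`). Convergence in
`‖·‖_φ` and uniform convergence then both follow from convergence in `L²`.

For the error, `f` minus its projection is orthogonal to `V`, so `φ(· - x)` may be replaced by `φ(·
- x) - v` for any `v ∈ V`. Taking for `v` the spectrum of `φ` times the periodized exponential
leaves only frequencies `|ξ| ≥ π/λ`, where the moment controls the energy
(`exists_mem_shiftSpace_norm_sub_sq_le`). This gives the constant 4 and the first term of the weight
series alone, which is stronger than required. -/

noncomputable section

namespace GenSampling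

/-! ### Riesz sequences and biorthogonal expansions in a Hilbert space. -/

section RieszSequence

variable {ι H : Type*} [NormedAddCommGroup H] [InnerProductSpace ℂ H]

theorem IsRieszBasisOfSpan.exists_finset_bounds {e : ι → H} (h : IsRieszBasisOfSpan e) :
    ∃ A B : ℝ, 0 < A ∧ 0 < B ∧ ∀ (s : Finset ι) (c : ι → ℂ),
      A * ∑ i ∈ s, ‖c i‖ ^ 2 ≤ ‖∑ i ∈ s, c i • e i‖ ^ 2 ∧
        ‖∑ i ∈ s, c i • e i‖ ^ 2 ≤ B * ∑ i ∈ s, ‖c i‖ ^ 2 := by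
  classical
  obtain ⟨A, B, hA, hB, h⟩ := h
  refine ⟨A, B, hA, hB, fun s c => ?_⟩
  let d : ι →₀ ℂ := Finsupp.onFinset s (fun i => if i ∈ s then c i else 0) (by
    intro i hi; by_contra h'; simp [h'] at hi)
  have hd : ∀ i ∈ s, d i = c i := fun i hi => by simp [d, hi]
  have hsub : d.support ⊆ s := Finsupp.support_onFinset_subset
  have h1 : ∑ i ∈ d.support, ‖d i‖ ^ 2 = ∑ i ∈ s, ‖c i‖ ^ 2 := by
    rw [Finset.sum_subset hsub fun i _ hi => by simp [Finsupp.notMem_support_iff.1 hi]]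
    exact Finset.sum_congr rfl fun i hi => by rw [hd i hi]
  have h2 : ∑ i ∈ d.support, d i • e i = ∑ i ∈ s, c i • e i := by
    rw [Finset.sum_subset hsub fun i _ hi => by simp [Finsupp.notMem_support_iff.1 hi]]
    exact Finset.sum_congr rfl fun i hi => by rw [hd i hi]
  rw [← h1, ← h2]
  exact h d

/-- Analysis is the adjoint of synthesis: testing the synthesis bound on the coefficients `⟨e i, f⟩`
themselves gives the Bessel inequality. -/
theorem sum_inner_sq_le_of_synthesis_le {e : ι → H} {B : ℝ} (hB : 0 < B)
    (h : ∀ (s : Finset ι) (c : ι → ℂ),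
      ‖∑ i ∈ s, c i • e i‖ ^ 2 ≤ B * ∑ i ∈ s, ‖c i‖ ^ 2) (f : H) (s : Finset ι) :
    ∑ i ∈ s, ‖inner ℂ (e i) f‖ ^ 2 ≤ B * ‖f‖ ^ 2 := by
  set S := ∑ i ∈ s, ‖inner ℂ (e i) f‖ ^ 2 with hS
  have hS0 : 0 ≤ S := Finset.sum_nonneg fun _ _ => by positivity
  have h1 : (S : ℂ) = inner ℂ (∑ i ∈ s, inner ℂ (e i) f • e i) f := by
    rw [sum_inner, hS]
    push_cast
    exact Finset.sum_congr rfl fun i _ => by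
      rw [inner_smul_left, ← Complex.normSq_eq_conj_mul_self, Complex.normSq_eq_norm_sq]
      push_cast; rfl
  have h2 : S ≤ ‖∑ i ∈ s, inner ℂ (e i) f • e i‖ * ‖f‖ := by
    have := norm_inner_le_norm (𝕜 := ℂ) (∑ i ∈ s, inner ℂ (e i) f • e i) f
    rwa [← h1, Complex.norm_real, Real.norm_of_nonneg hS0] at this
  have h3 := h s fun i => inner ℂ (e i) f
  rcases hS0.eq_or_lt with h0 | h0
  · rw [← h0]; positivity
  · have : S ^ 2 ≤ B * S * ‖f‖ ^ 2 := by
      calc S ^ 2 ≤ (‖∑ i ∈ s, inner ℂ (e i) f • e i‖ * ‖f‖) ^ 2 := by gcongr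
        _ = ‖∑ i ∈ s, inner ℂ (e i) f • e i‖ ^ 2 * ‖f‖ ^ 2 := by ring
        _ ≤ B * S * ‖f‖ ^ 2 := by gcongr
    have : S * S ≤ S * (B * ‖f‖ ^ 2) := by linarith
    exact le_of_mul_le_mul_left this h0

/-- An element of the closed span is controlled by its pairings with the span. Biorthogonality turns
such a pairing into a coefficient sum, and Cauchy–Schwarz with the lower Riesz bound finishes. -/
theorem norm_sum_biorthogonal_sq_le [DecidableEq ι] {e e' : ι → H} {A : ℝ} (hA : 0 < A)
    (h : ∀ (s : Finset ι) (c : ι → ℂ), A * ∑ i ∈ s, ‖c i‖ ^ 2 ≤ ‖∑ i ∈ s, c i • e i‖ ^ 2)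
    (hmem : ∀ i, e' i ∈ (Submodule.span ℂ (Set.range e)).topologicalClosure)
    (hbi : ∀ i j, inner ℂ (e i) (e' j) = if i = j then 1 else 0) (s : Finset ι) (c : ι → ℂ) :
    ‖∑ i ∈ s, c i • e' i‖ ^ 2 ≤ A⁻¹ * ∑ i ∈ s, ‖c i‖ ^ 2 := by
  set u := ∑ i ∈ s, c i • e' i with hu
  set S := ∑ i ∈ s, ‖c i‖ ^ 2 with hS
  have hS0 : 0 ≤ S := Finset.sum_nonneg fun _ _ => by positivity
  have huV : u ∈ (Submodule.span ℂ (Set.range e)).topologicalClosure :=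
    Submodule.sum_mem _ fun i _ => Submodule.smul_mem _ _ (hmem i)
  -- Both sides are continuous in `v`, so the inequality need only be checked on finite
  -- combinations.
  have key : ∀ v ∈ closure (Submodule.span ℂ (Set.range e) : Set H),
      ‖inner ℂ v u‖ ^ 2 ≤ A⁻¹ * ‖v‖ ^ 2 * S := by
    refine closure_minimal (fun v hv => ?_)
      (isClosed_le (f := fun v : H => ‖inner ℂ v u‖ ^ 2) (g := fun v : H => A⁻¹ * ‖v‖ ^ 2 * S)
        (by fun_prop) (by fun_prop))
    obtain ⟨d, rfl⟩ := (Finsupp.mem_span_range_iff_exists_finsupp).1 hv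
    have h1 : ∀ j, inner ℂ (d.sum fun i a => a • e i) (e' j) = conj (d j) := fun j => by
      rw [Finsupp.sum, sum_inner]
      simp only [inner_smul_left, hbi, mul_ite, mul_one, mul_zero, Finset.sum_ite_eq',
        Finsupp.mem_support_iff]
      by_cases hj : d j = 0 <;> simp [hj]
    have h2 : inner ℂ (d.sum fun i a => a • e i) u = ∑ i ∈ s, c i * conj (d i) := by
      rw [hu, inner_sum]
      exact Finset.sum_congr rfl fun i _ => by rw [inner_smul_right, h1]
    have h3 : ∑ i ∈ s, ‖d i‖ ^ 2 ≤ ∑ i ∈ d.support, ‖d i‖ ^ 2 :=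
      calc ∑ i ∈ s, ‖d i‖ ^ 2 = ∑ i ∈ s ∩ d.support, ‖d i‖ ^ 2 := by
            refine (Finset.sum_subset Finset.inter_subset_left fun i hi hi' => ?_).symm
            have : d i = 0 := by
              by_contra h0
              exact hi' (Finset.mem_inter.2 ⟨hi, Finsupp.mem_support_iff.2 h0⟩)
            simp [this]
        _ ≤ _ := Finset.sum_le_sum_of_subset_of_nonneg Finset.inter_subset_right
            fun _ _ _ => by positivity
    have h4 : ∑ i ∈ d.support, ‖d i‖ ^ 2 ≤ A⁻¹ * ‖d.sum fun i a => a • e i‖ ^ 2 := by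
      rw [le_inv_mul_iff₀ hA]
      exact h d.support d
    show ‖inner ℂ (d.sum fun i a => a • e i) u‖ ^ 2 ≤ _
    rw [h2]
    calc ‖∑ i ∈ s, c i * conj (d i)‖ ^ 2 ≤ (∑ i ∈ s, ‖c i‖ * ‖d i‖) ^ 2 := by
          gcongr
          refine (norm_sum_le _ _).trans (le_of_eq (Finset.sum_congr rfl fun i _ => ?_))
          rw [norm_mul, RCLike.norm_conj]
      _ ≤ (∑ i ∈ s, ‖c i‖ ^ 2) * ∑ i ∈ s, ‖d i‖ ^ 2 := Finset.sum_mul_sq_le_sq_mul_sq _ _ _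
      _ ≤ S * (A⁻¹ * ‖d.sum fun i a => a • e i‖ ^ 2) := by
          gcongr
          exact h3.trans h4
      _ = _ := by ring
  -- Since `u` lies in the closed span, `v = u` is allowed; one factor `‖u‖²` then cancels.
  have h5 := key u huV
  rw [inner_self_eq_norm_sq_to_K] at h5
  have h7 : (‖u‖ ^ 2) ^ 2 ≤ A⁻¹ * ‖u‖ ^ 2 * S := by simpa using h5
  rcases (sq_nonneg ‖u‖).eq_or_lt with h0 | h0
  · rw [← h0]; positivity
  · have : ‖u‖ ^ 2 * ‖u‖ ^ 2 ≤ ‖u‖ ^ 2 * (A⁻¹ * S) := by linarith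
    exact le_of_mul_le_mul_left this h0

/-- Expansion of the orthogonal projection onto the span of a Riesz sequence `e` along its
biorthogonal system `e'`. -/
theorem IsRieszBasisOfSpan.hasSum_starProjection [CompleteSpace H] [DecidableEq ι] {e e' : ι → H}
    (he : IsRieszBasisOfSpan e)
    (hmem : ∀ i, e' i ∈ (Submodule.span ℂ (Set.range e)).topologicalClosure)
    (hbi : ∀ i j, inner ℂ (e i) (e' j) = if i = j then 1 else 0) (f : H) :
    HasSum (fun i => inner ℂ (e i) f • e' i)
      ((Submodule.span ℂ (Set.range e)).topologicalClosure.starProjection f) := by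
  obtain ⟨A, B, hA, hB, h⟩ := he.exists_finset_bounds
  set V := (Submodule.span ℂ (Set.range e)).topologicalClosure with hV
  have hsq : Summable fun i => ‖inner ℂ (e i) f‖ ^ 2 :=
    summable_of_sum_le (fun _ => by positivity)
      (sum_inner_sq_le_of_synthesis_le hB (fun s c => (h s c).2) f)
  have hdual := norm_sum_biorthogonal_sq_le hA (fun s c => (h s c).1) hmem hbi
  -- Cauchy criterion: the bound for `e'` converts small tails of the square-summable coefficients
  -- into small tails of the series.
  have hsum : Summable fun i => inner ℂ (e i) f • e' i := by
    rw [summable_iff_vanishing_norm] at hsq ⊢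
    intro ε hε
    obtain ⟨s, hs⟩ := hsq (A * ε ^ 2) (by positivity)
    refine ⟨s, fun t ht => ?_⟩
    have h1 := hdual t fun i => inner ℂ (e i) f
    have h2 := hs t ht
    rw [Real.norm_of_nonneg (Finset.sum_nonneg fun _ _ => by positivity)] at h2
    have h3 : ‖∑ i ∈ t, inner ℂ (e i) f • e' i‖ ^ 2 < ε ^ 2 :=
      h1.trans_lt (by rwa [inv_mul_lt_iff₀ hA])
    exact lt_of_pow_lt_pow_left₀ 2 hε.le h3
  obtain ⟨v, hv⟩ := hsum
  have hvV : v ∈ V :=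
    (Submodule.isClosed_topologicalClosure _).mem_of_tendsto hv
      (Eventually.of_forall fun s =>
        Submodule.sum_mem _ fun i _ => Submodule.smul_mem _ _ (hmem i))
  -- The sum `v` and `f` have equal pairings with each `e j`, so `f - v` is orthogonal to the span
  -- and `v` is the projection.
  have hin : ∀ j, inner ℂ (e j) v = inner ℂ (e j) f := fun j => by
    have h1 := (innerSL ℂ (e j)).hasSum hv
    refine h1.unique ?_
    have h2 : (fun i => innerSL ℂ (e j) (inner ℂ (e i) f • e' i)) =
        fun i => if i = j then inner ℂ (e j) f else 0 := by
      funext i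
      rw [innerSL_apply_apply, inner_smul_right, hbi]
      by_cases hij : i = j
      · subst hij; simp
      · simp [hij, Ne.symm hij]
    have h3 := hasSum_ite_eq j (inner ℂ (e j) f)
    rwa [← h2] at h3
  have hproj : V.starProjection f = v := by
    refine Submodule.eq_starProjection_of_mem_of_inner_eq_zero hvV fun w hw => ?_
    refine closure_minimal (s := (Submodule.span ℂ (Set.range e) : Set H))
      (t := {w | inner ℂ (f - v) w = 0}) (fun w hw => ?_)
      (isClosed_eq (by fun_prop) continuous_const) hw
    induction hw using Submodule.span_induction with
    | mem x hx =>
      obtain ⟨j, rfl⟩ := hx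
      show inner ℂ (f - v) (e j) = 0
      rw [inner_eq_zero_symm, inner_sub_right, hin, sub_self]
    | zero => simp
    | add x y _ _ hx hy =>
      show inner ℂ (f - v) (x + y) = 0
      rw [inner_add_right, show inner ℂ (f - v) x = 0 from hx,
        show inner ℂ (f - v) y = 0 from hy, add_zero]
    | smul a x _ hx =>
      show inner ℂ (f - v) (a • x) = 0
      rw [inner_smul_right, show inner ℂ (f - v) x = 0 from hx, mul_zero]
  rwa [hproj]

end RieszSequence

/-! ### The `L²` Fourier transform, translations and the prefilter. -/

section FourierL2

/-- The `L²` transform agrees with the distributional one, so it moves onto test functions.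
Identities between spectra are then proved almost everywhere by testing. -/
theorem integral_smul_fourier_eq (f : L2R) {h : ℝ → ℂ} (hc : HasCompactSupport h)
    (hs : ContDiff ℝ (⊤ : ℕ∞) h) :
    ∫ x, h x * (𝓕 f : L2R) x = ∫ x, 𝓕 h x * f x := by
  have h1 := congrArg (fun D => D (hc.toSchwartzMap hs)) (Lp.fourier_toTemperedDistribution_eq f)
  simp only [TemperedDistribution.fourier_apply, Lp.toTemperedDistribution_apply,
    smul_eq_mul] at h1
  exact h1.symm

theorem integral_smul_fourierInv_eq (f : L2R) {h : ℝ → ℂ} (hc : HasCompactSupport h)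
    (hs : ContDiff ℝ (⊤ : ℕ∞) h) :
    ∫ x, h x * (𝓕⁻ f : L2R) x = ∫ x, 𝓕⁻ h x * f x := by
  have h1 := congrArg (fun D => D (hc.toSchwartzMap hs))
    (Lp.fourierInv_toTemperedDistribution_eq f)
  simp only [TemperedDistribution.fourierInv_apply, Lp.toTemperedDistribution_apply,
    smul_eq_mul, SchwartzMap.fourierInv_coe] at h1
  exact h1.symm

theorem locallyIntegrable_coe (f : L2R) : LocallyIntegrable f volume :=
  (Lp.memLp f).locallyIntegrable (by norm_num)

/-- The `L²` inverse transform of an integrable function is given by the integral. -/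
theorem fourierInv_toLp_ae_eq {k : ℝ → ℂ} (h1 : Integrable k) (h2 : MemLp k 2 volume) :
    ((𝓕⁻ (h2.toLp k) : L2R) : ℝ → ℂ) =ᵐ[volume] 𝓕⁻ k := by
  have hcont : Continuous (𝓕⁻ k) := by
    have : 𝓕⁻ k = fun x => 𝓕 k (-x) := by
      funext x; rw [Real.fourierInv_eq_fourier_neg]
    rw [this]
    exact (VectorFourier.fourierIntegral_continuous Real.continuous_fourierChar
      (by fun_prop) h1).comp continuous_neg
  refine ae_eq_of_integral_contDiff_smul_eq (locallyIntegrable_coe _) hcont.locallyIntegrable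
    fun g hg hgc => ?_
  have hc : HasCompactSupport fun x => (g x : ℂ) := hgc.comp_left Complex.ofReal_zero
  have hs : ContDiff ℝ (⊤ : ℕ∞) fun x => (g x : ℂ) := Complex.ofRealCLM.contDiff.comp hg
  have h3 := integral_smul_fourierInv_eq (h2.toLp k) hc hs
  simp only [Complex.real_smul]
  rw [h3, integral_congr_ae (g := fun x => 𝓕⁻ (fun x => (g x : ℂ)) x * k x)
    (by filter_upwards [h2.coeFn_toLp] with x hx; rw [hx])]
  have hgi : Integrable fun x => (g x : ℂ) := hs.continuous.integrable_of_hasCompactSupport hc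
  have h4 := VectorFourier.integral_fourierIntegral_smul_eq_flip (μ := volume) (ν := volume)
    (L := -innerₗ ℝ) (e := Real.fourierChar) (f := fun x => (g x : ℂ)) (g := k)
    Real.continuous_fourierChar (by simp only [LinearMap.neg_apply, innerₗ_apply_apply]; fun_prop) hgi h1
  simp only [smul_eq_mul] at h4
  have h5 : VectorFourier.fourierIntegral Real.fourierChar volume (-innerₗ ℝ)
      (fun x => (g x : ℂ)) = 𝓕⁻ (fun x => (g x : ℂ)) := by
    funext x
    simp [VectorFourier.fourierIntegral, Real.fourierInv_eq]
  have h6 : VectorFourier.fourierIntegral Real.fourierChar volume (-innerₗ ℝ).flip k = 𝓕⁻ k := by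
    funext x
    simp [VectorFourier.fourierIntegral, Real.fourierInv_eq, mul_comm]
  rw [h5, h6] at h4
  exact h4

/-- A character times a test function is again a test function; after moving the transform onto it,
the character becomes a shift of the integration variable. -/
theorem fourier_translate_ae_eq (t : ℝ) (f : L2R) :
    ((𝓕 (translate t f) : L2R) : ℝ → ℂ) =ᵐ[volume]
      fun η => (Real.fourierChar (-(t * η)) : ℂ) * (𝓕 f : L2R) η := by
  have hsm : ContDiff ℝ (⊤ : ℕ∞) fun η : ℝ => (Real.fourierChar (-(t * η)) : ℂ) := by
    have : (fun η : ℝ => (Real.fourierChar (-(t * η)) : ℂ)) =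
        fun η => Complex.exp (((2 * Real.pi * (-(t * η)) : ℝ) : ℂ) * Complex.I) := by
      funext η; rw [Real.fourierChar_apply]
    rw [this]
    refine ContDiff.cexp (ContDiff.mul (Complex.ofRealCLM.contDiff.comp ?_) contDiff_const)
    exact contDiff_const.mul (contDiff_const.mul contDiff_id).neg
  have hli : LocallyIntegrable
      (fun η => (Real.fourierChar (-(t * η)) : ℂ) * (𝓕 f : L2R) η) volume := by
    refine (locallyIntegrable_coe (𝓕 f)).mono
      (hsm.continuous.aestronglyMeasurable.mul (Lp.aestronglyMeasurable _))
      (Eventually.of_forall fun η => ?_)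
    rw [norm_mul, Circle.norm_coe, one_mul]
  refine ae_eq_of_integral_contDiff_smul_eq (locallyIntegrable_coe _) hli fun g hg hgc => ?_
  have hc : HasCompactSupport fun x => (g x : ℂ) := hgc.comp_left Complex.ofReal_zero
  have hs : ContDiff ℝ (⊤ : ℕ∞) fun x => (g x : ℂ) := Complex.ofRealCLM.contDiff.comp hg
  simp only [Complex.real_smul]
  have h1 := integral_smul_fourier_eq f
    (h := fun η => (g η : ℂ) * (Real.fourierChar (-(t * η)) : ℂ)) hc.mul_right (hs.mul hsm)
  simp only [mul_assoc] at h1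
  rw [h1, integral_smul_fourier_eq _ hc hs, ← integral_add_right_eq_self _ t]
  refine integral_congr_ae ?_
  have h2 := (measurePreserving_add_right volume t).quasiMeasurePreserving.ae
    (Lp.coeFn_compMeasurePreserving f (measurePreserving_sub_right volume t))
  filter_upwards [h2] with x hx
  have h3 : (translate t f : ℝ → ℂ) (x + t) = f x := by
    rw [translate, hx]; simp
  rw [h3]
  congr 1
  simp only [Real.fourier_real_eq]
  refine integral_congr_ae (Eventually.of_forall fun v => ?_)
  simp only [Circle.smul_def, smul_eq_mul]
  rw [show -(v * (x + t)) = -(v * x) + -(t * v) by ring, AddChar.map_add_eq_mul, Circle.coe_mul]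
  ring

theorem coeFn_translate (t : ℝ) (φ : L2R) :
    (translate t φ : ℝ → ℂ) =ᵐ[volume] fun x => φ (x - t) :=
  Lp.coeFn_compMeasurePreserving φ (measurePreserving_sub_right volume t)

theorem inner_L2_eq (f g : L2R) : inner ℂ f g = ∫ x, g x * conj (f x) := by
  rw [L2.inner_def]; rfl

/-- Point evaluation of `P_φ f` is a pairing in `L²`; this is what reduces sampling to projections.
-/
theorem prefilter_eq_inner (φ f : L2R) (x : ℝ) :
    prefilter φ f x = inner ℂ (translate x φ) f := by
  rw [inner_L2_eq, prefilter]
  refine integral_congr_ae ?_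
  filter_upwards [coeFn_translate x φ] with y hy
  rw [hy]

theorem norm_translate (t : ℝ) (φ : L2R) : ‖translate t φ‖ = ‖φ‖ :=
  Lp.norm_compMeasurePreserving _ _

theorem translate_translate (s t : ℝ) (φ : L2R) :
    translate s (translate t φ) = translate (s + t) φ := by
  refine Lp.ext ?_
  filter_upwards [coeFn_translate s (translate t φ), coeFn_translate (s + t) φ,
    (measurePreserving_sub_right volume s).quasiMeasurePreserving.ae (coeFn_translate t φ)]
    with x h2 h3 h4
  rw [h2, h3, h4, sub_sub]

theorem inner_translate_translate (t : ℝ) (f g : L2R) :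
    inner ℂ (translate t f) (translate t g) = inner ℂ f g :=
  (Lp.compMeasurePreservingₗᵢ ℂ (fun x : ℝ => x - t)
    (measurePreserving_sub_right volume t)).inner_map_map f g

theorem prefilter_translate (φ f : L2R) (t x : ℝ) :
    prefilter φ (translate t f) x = prefilter φ f (x - t) := by
  rw [prefilter_eq_inner, prefilter_eq_inner, ← inner_translate_translate t (translate (x - t) φ),
    translate_translate]
  ring_nf

theorem norm_prefilter_le (φ f : L2R) (x : ℝ) : ‖prefilter φ f x‖ ≤ ‖φ‖ * ‖f‖ := by
  rw [prefilter_eq_inner, ← norm_translate x φ]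
  exact norm_inner_le_norm _ _

/-- The prefilter as a linear map. -/
def prefilterₗ (φ : L2R) : L2R →ₗ[ℂ] ℝ → ℂ where
  toFun := prefilter φ
  map_add' f g := by
    funext x; simp only [Pi.add_apply, prefilter_eq_inner, inner_add_right]
  map_smul' c f := by
    funext x
    simp only [Pi.smul_apply, prefilter_eq_inner, inner_smul_right, RingHom.id_apply, smul_eq_mul]

theorem prefilterₗ_apply (φ f : L2R) : prefilterₗ φ f = prefilter φ f := rfl

/-- The spectrum `𝓕 f · conj (𝓕 φ)` of `P_φ f` in the normalization of Mathlib. -/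
def filteredSpectrum (φ f : L2R) (η : ℝ) : ℂ := (𝓕 f : L2R) η * conj ((𝓕 φ : L2R) η)

theorem integrable_filteredSpectrum (φ f : L2R) : Integrable (filteredSpectrum φ f) := by
  have := L2.integrable_inner (𝕜 := ℂ) (𝓕 φ : L2R) (𝓕 f : L2R)
  exact this

/-- Parseval applied to the pairing with a translate. The identity holds at every point, because
both sides are genuine integrals. -/
theorem prefilter_eq_fourierInv (φ f : L2R) : prefilter φ f = 𝓕⁻ (filteredSpectrum φ f) := by
  funext x
  rw [prefilter_eq_inner, ← Lp.inner_fourier_eq, inner_L2_eq, Real.fourierInv_eq]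
  refine integral_congr_ae ?_
  filter_upwards [fourier_translate_ae_eq x φ] with η hη
  rw [hη, filteredSpectrum, map_mul, Circle.smul_def, smul_eq_mul, ← Circle.coe_inv_eq_conj,
    ← AddChar.map_neg_eq_inv]
  simp only [neg_neg, RCLike.inner_apply, conj_trivial]
  ring

theorem quasiMeasurePreserving_div_two_pi :
    Measure.QuasiMeasurePreserving (fun ξ : ℝ => ξ / (2 * Real.pi)) volume volume := by
  have := Measure.quasiMeasurePreserving_smul (volume : Measure ℝ) (r := (2 * Real.pi)⁻¹) (by positivity)
  simpa only [smul_eq_mul, ← div_eq_inv_mul] using this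

/-- The angular-frequency transform of a function given by an inverse Fourier integral. -/
theorem fourierL2_fourierInv {k : ℝ → ℂ} (h1 : Integrable k) (h2 : MemLp k 2 volume) :
    MemLp (𝓕⁻ k) 2 volume ∧ fourierL2 (𝓕⁻ k) =ᵐ[volume] fun ξ =>
      (((Real.sqrt (2 * Real.pi))⁻¹ : ℝ) : ℂ) * k (ξ / (2 * Real.pi)) := by
  have h3 := fourierInv_toLp_ae_eq h1 h2
  have h4 : MemLp (𝓕⁻ k) 2 volume := (memLp_congr_ae h3).1 (Lp.memLp _)
  refine ⟨h4, ?_⟩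
  have h5 : h4.toLp (𝓕⁻ k) = 𝓕⁻ (h2.toLp k) := by
    refine Lp.ext (h4.coeFn_toLp.trans h3.symm)
  filter_upwards [quasiMeasurePreserving_div_two_pi.ae h2.coeFn_toLp] with ξ hξ
  rw [fourierL2, dif_pos h4, h5, FourierTransform.fourier_fourierInv_eq, hξ]

theorem fourierL2_coe (φ : L2R) (ξ : ℝ) : fourierL2 φ ξ =
    (((Real.sqrt (2 * Real.pi))⁻¹ : ℝ) : ℂ) * (𝓕 φ : L2R) (ξ / (2 * Real.pi)) := by
  rw [fourierL2, dif_pos (Lp.memLp φ), Lp.toLp_coeFn]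

end FourierL2

/-! ### Periodization and push-forward of densities to the circle. -/

section Periodization

open scoped ENNReal

variable {T : ℝ}

theorem periodic_tsum_shift (T : ℝ) (F : ℝ → ℝ≥0∞) :
    Function.Periodic (fun x => ∑' n : ℤ, F (x + n * T)) T := fun x => by
  show ∑' n : ℤ, F (x + T + n * T) = ∑' n : ℤ, F (x + n * T)
  rw [← (Equiv.addRight (1 : ℤ)).tsum_eq fun n : ℤ => F (x + n * T)]
  refine tsum_congr fun n => congrArg F ?_
  simp only [Equiv.coe_addRight, Int.cast_add, Int.cast_one]
  ring

/-- The periodization `∑ₙ F(x + nT)` as a function on the circle. -/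
def periodization (T : ℝ) (F : ℝ → ℝ≥0∞) : AddCircle T → ℝ≥0∞ := (periodic_tsum_shift T F).lift

theorem periodization_coe (F : ℝ → ℝ≥0∞) (x : ℝ) :
    periodization T F (x : AddCircle T) = ∑' n : ℤ, F (x + n * T) := rfl

theorem measurable_periodization {F : ℝ → ℝ≥0∞} (hF : Measurable F) :
    Measurable (periodization T F) := by
  refine measurable_from_quotient.2 ?_
  show Measurable fun x => ∑' n : ℤ, F (x + n * T)
  fun_prop

variable [hT : Fact (0 < T)]

theorem lintegral_eq_lintegral_Ioc_tsum {F : ℝ → ℝ≥0∞} (hF : Measurable F) :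
    ∫⁻ x, F x = ∫⁻ x in Set.Ioc 0 (0 + T), ∑' n : ℤ, F (x + n * T) := by
  rw [(isAddFundamentalDomain_Ioc hT.out 0 volume).lintegral_eq_tsum',
    lintegral_tsum fun n => by fun_prop]
  have hbij : Function.Bijective
      (fun n : ℤ => (⟨n • T, n, rfl⟩ : AddSubgroup.zmultiples T)) :=
    (Equiv.ofInjective (fun n : ℤ => n • T) (zsmul_left_strictMono hT.out).injective).bijective
  -- The fundamental domain formula translates by inverses, hence the change of sign in the index.
  rw [← ((Equiv.neg ℤ).trans (Equiv.ofBijective _ hbij)).tsum_eq]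
  refine tsum_congr fun n => lintegral_congr fun x => congrArg F ?_
  simp [AddSubgroup.vadd_def, add_comm]

/-- The preimage of a set on the circle is periodic, so its indicator comes out of the sum over
shifts. -/
theorem map_withDensity_coe {F : ℝ → ℝ≥0∞} (hF : Measurable F) :
    (volume.withDensity F).map ((↑) : ℝ → AddCircle T) =
      volume.withDensity (periodization T F) := by
  ext E hE
  have hpre : MeasurableSet (((↑) : ℝ → AddCircle T) ⁻¹' E) := AddCircle.measurable_mk' hE
  rw [Measure.map_apply AddCircle.measurable_mk' hE, withDensity_apply _ hpre,
    withDensity_apply _ hE, ← lintegral_indicator hpre, ← lintegral_indicator hE,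
    lintegral_eq_lintegral_Ioc_tsum (T := T) (hF.indicator hpre), ← AddCircle.lintegral_preimage T 0]
  refine lintegral_congr fun x => ?_
  have hx : ∀ n : ℤ, ((x + n * T : ℝ) : AddCircle T) = x := fun n => by
    rw [← zsmul_eq_mul, AddCircle.coe_add, AddCircle.coe_zsmul, AddCircle.coe_period]; simp
  by_cases hxE : (x : AddCircle T) ∈ E
  · simp [Set.indicator, hx, hxE, periodization_coe]
  · simp [Set.indicator, hx, hxE]

theorem quasiMeasurePreserving_coe :
    Measure.QuasiMeasurePreserving ((↑) : ℝ → AddCircle T) volume volume := by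
  refine ⟨AddCircle.measurable_mk', ?_⟩
  -- The periodization of 1 is infinite everywhere, which is harmless: only absolute continuity is
  -- needed.
  have h := map_withDensity_coe (T := T) (F := 1) measurable_one
  rw [withDensity_one] at h
  rw [h]
  exact withDensity_absolutelyContinuous _ _

end Periodization

/-! ### Trigonometric approximation for finite measures on the circle. -/

section TrigonometricApproximation

open scoped ENNReal NNReal

variable {T : ℝ} [hT : Fact (0 < T)]

theorem exists_trigonometric_eLpNorm_sub_le (μ : Measure (AddCircle T)) [IsFiniteMeasure μ]
    {f : AddCircle T → ℂ} (hf : MemLp f 2 μ) {ε : ℝ} (hε : 0 < ε) :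
    ∃ (s : Finset ℤ) (c : ℤ → ℂ),
      eLpNorm (fun q => f q - ∑ n ∈ s, c n * fourier n q) 2 μ ≤ ENNReal.ofReal ε := by
  have hd := (ContinuousMap.toLp_denseRange ℂ μ ℂ (p := 2)
    ENNReal.ofNat_ne_top).topologicalClosure_map_submodule (span_fourier_closure_eq_top (T := T))
  have hmem : hf.toLp f ∈ (Submodule.map (ContinuousMap.toLp (E := ℂ) 2 μ ℂ).toLinearMap
      (Submodule.span ℂ (Set.range (@fourier T)))).topologicalClosure := by
    rw [hd]; trivial
  obtain ⟨y, ⟨p, hp, rfl⟩, hy⟩ := Metric.mem_closure_iff.1 hmem ε hε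
  obtain ⟨c, rfl⟩ := (Finsupp.mem_span_range_iff_exists_finsupp).1 hp
  refine ⟨c.support, c, ?_⟩
  rw [Lp.dist_def] at hy
  have hcongr : eLpNorm (fun q => f q - ∑ n ∈ c.support, c n * fourier n q) 2 μ =
      eLpNorm (hf.toLp f - ContinuousMap.toLp 2 μ ℂ (c.sum fun i a => a • fourier i) :
        AddCircle T → ℂ) 2 μ := by
    refine eLpNorm_congr_ae ?_
    filter_upwards [hf.coeFn_toLp, ContinuousMap.coeFn_toLp (p := 2) (𝕜 := ℂ) μ
      (c.sum fun i a => a • fourier i)] with q h1 h2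
    rw [Pi.sub_apply, h1, h2, Finsupp.sum, ContinuousMap.sum_apply]
    rfl
  rw [hcongr]
  refine (ENNReal.le_ofReal_iff_toReal_le ?_ hε.le).2 hy.le
  exact ((Lp.memLp _).sub (Lp.memLp _)).eLpNorm_ne_top

/-- Trigonometric polynomials are dense in `L²(μ + ν)`, so one polynomial approximates the indicator
of `E` for both measures at once and the norm inequality passes to it. -/
theorem measure_le_of_trigonometric (μ ν : Measure (AddCircle T)) [IsFiniteMeasure μ]
    [IsFiniteMeasure ν] (K : ℝ≥0)
    (h : ∀ (s : Finset ℤ) (c : ℤ → ℂ), eLpNorm (fun q => ∑ n ∈ s, c n * fourier n q) 2 μ ≤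
      K * eLpNorm (fun q => ∑ n ∈ s, c n * fourier n q) 2 ν)
    {E : Set (AddCircle T)} (hE : MeasurableSet E) : μ E ≤ (K : ℝ≥0∞) ^ 2 * ν E := by
  set f : AddCircle T → ℂ := E.indicator fun _ => 1 with hfdef
  have hfm : Measurable f := measurable_const.indicator hE
  have hf : MemLp f 2 (μ + ν) := memLp_indicator_const 2 hE 1 (Or.inr (measure_ne_top _ _))
  have hnorm : ∀ ρ : Measure (AddCircle T), eLpNorm f 2 ρ = ρ E ^ (1 / 2 : ℝ) := fun ρ => by
    rw [hfdef, eLpNorm_indicator_const hE two_ne_zero ENNReal.ofNat_ne_top]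
    simp
  have key : eLpNorm f 2 μ ≤ K * eLpNorm f 2 ν := by
    refine ENNReal.le_of_forall_pos_le_add fun δ hδ _ => ?_
    -- The approximation error enters once through `μ` and `K` times through `ν`, hence the divisor
    -- `1 + K`.
    obtain ⟨s, c, hsc⟩ := exists_trigonometric_eLpNorm_sub_le (μ + ν) hf
      (ε := δ / (1 + K)) (by positivity)
    set p : AddCircle T → ℂ := fun q => ∑ n ∈ s, c n * fourier n q with hp
    have hpm : Measurable p := by
      have : Continuous p := by rw [hp]; fun_prop
      exact this.measurable
    have h1 : eLpNorm (f - p) 2 μ ≤ ENNReal.ofReal (δ / (1 + K)) :=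
      (eLpNorm_mono_measure _ (Measure.le_add_right le_rfl)).trans hsc
    have h2 : eLpNorm (p - f) 2 ν ≤ ENNReal.ofReal (δ / (1 + K)) := by
      rw [eLpNorm_sub_comm]
      exact (eLpNorm_mono_measure _ (Measure.le_add_left le_rfl)).trans hsc
    calc eLpNorm f 2 μ = eLpNorm ((f - p) + p) 2 μ := by rw [sub_add_cancel]
      _ ≤ eLpNorm (f - p) 2 μ + eLpNorm p 2 μ := eLpNorm_add_le
          (hfm.sub hpm).aestronglyMeasurable hpm.aestronglyMeasurable one_le_two
      _ ≤ ENNReal.ofReal (δ / (1 + K)) + K * eLpNorm ((p - f) + f) 2 ν := by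
          rw [sub_add_cancel]; exact add_le_add h1 (h s c)
      _ ≤ ENNReal.ofReal (δ / (1 + K)) +
          K * (ENNReal.ofReal (δ / (1 + K)) + eLpNorm f 2 ν) := by
          gcongr
          exact (eLpNorm_add_le (hpm.sub hfm).aestronglyMeasurable hfm.aestronglyMeasurable
            one_le_two).trans (by gcongr)
      _ = K * eLpNorm f 2 ν + (1 + K) * ENNReal.ofReal (δ / (1 + K)) := by ring
      _ = K * eLpNorm f 2 ν + δ := by
          congr 1
          rw [show (1 + K : ℝ≥0∞) = ENNReal.ofReal (1 + K) by
            rw [ENNReal.ofReal_add zero_le_one K.coe_nonneg]; simp, ← ENNReal.ofReal_mul (by positivity),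
            mul_div_cancel₀ _ (by positivity), ENNReal.ofReal_coe_nnreal]
  rw [hnorm, hnorm] at key
  have h3 := ENNReal.rpow_le_rpow key (zero_le_two : (0 : ℝ) ≤ 2)
  rw [ENNReal.mul_rpow_of_nonneg _ _ zero_le_two, ← ENNReal.rpow_mul, ← ENNReal.rpow_mul] at h3
  simpa using h3

theorem eLpNorm_trigonometric_haar (s : Finset ℤ) (c : ℤ → ℂ) :
    eLpNorm (fun q : AddCircle T => ∑ n ∈ s, c n * fourier n q) 2 AddCircle.haarAddCircle =
      ENNReal.ofReal (Real.sqrt (∑ n ∈ s, ‖c n‖ ^ 2)) := by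
  have h1 : ‖∑ n ∈ s, c n • fourierLp (T := T) 2 n‖ = Real.sqrt (∑ n ∈ s, ‖c n‖ ^ 2) := by
    rw [← Real.sqrt_sq (norm_nonneg _)]
    congr 1
    have := (orthonormal_fourier (T := T)).inner_sum c c s
    rw [inner_self_eq_norm_sq_to_K] at this
    have h2 : ((‖∑ n ∈ s, c n • fourierLp (T := T) 2 n‖ ^ 2 : ℝ) : ℂ) =
        ((∑ n ∈ s, ‖c n‖ ^ 2 : ℝ) : ℂ) := by
      push_cast
      rw [show ((‖∑ n ∈ s, c n • fourierLp (T := T) 2 n‖ : ℝ) : ℂ) ^ 2 = _ from this]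
      refine Finset.sum_congr rfl fun n _ => ?_
      rw [← Complex.normSq_eq_conj_mul_self, Complex.normSq_eq_norm_sq]
      push_cast
      rfl
    exact_mod_cast h2
  rw [← h1, ofReal_norm, Lp.enorm_def]
  refine eLpNorm_congr_ae ?_
  have h2 : ContinuousMap.toLp 2 (AddCircle.haarAddCircle (T := T)) ℂ
      (∑ n ∈ s, c n • fourier n) = ∑ n ∈ s, c n • fourierLp (T := T) 2 n := by
    rw [map_sum]
    exact Finset.sum_congr rfl fun n _ => by rw [map_smul]
  rw [← h2]
  filter_upwards [ContinuousMap.coeFn_toLp (p := 2) (𝕜 := ℂ) AddCircle.haarAddCircle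
    (∑ n ∈ s, c n • fourier (T := T) n)] with q hq
  rw [hq, ContinuousMap.sum_apply]
  rfl

end TrigonometricApproximation

/-! ### The spectral measure on the circle and the shift-invariant space. -/

section SpectralMeasure

open scoped ENNReal NNReal

/-- The energy density `|𝓕 φ|²`. -/
def energyDensity (φ : L2R) (η : ℝ) : ℝ≥0∞ := ‖(𝓕 φ : L2R) η‖ₑ ^ 2

theorem measurable_energyDensity (φ : L2R) : Measurable (energyDensity φ) :=
  ((Lp.stronglyMeasurable (𝓕 φ : L2R)).measurable.enorm).pow_const 2

theorem eLpNorm_two_sq {α : Type*} [MeasurableSpace α] (μ : Measure α) (f : α → ℂ) :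
    eLpNorm f 2 μ ^ 2 = ∫⁻ x, ‖f x‖ₑ ^ 2 ∂μ := by
  rw [eLpNorm_eq_lintegral_rpow_enorm_toReal two_ne_zero ENNReal.ofNat_ne_top,
    ← ENNReal.rpow_two, ← ENNReal.rpow_mul]
  simp

theorem enorm_sq_eq_lintegral_fourier (f : L2R) : ‖f‖ₑ ^ 2 = ∫⁻ η, ‖(𝓕 f : L2R) η‖ₑ ^ 2 := by
  rw [← eLpNorm_two_sq, ← Lp.enorm_def, ← ofReal_norm, ← ofReal_norm, Lp.norm_fourier_eq]

instance isFiniteMeasure_energyDensity (φ : L2R) :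
    IsFiniteMeasure (volume.withDensity (energyDensity φ)) := by
  refine isFiniteMeasure_withDensity ?_
  show ∫⁻ η, ‖(𝓕 φ : L2R) η‖ₑ ^ 2 ≠ ∞
  rw [← enorm_sq_eq_lintegral_fourier]
  exact ENNReal.pow_ne_top enorm_ne_top

/-- The push-forward of the spectral measure `|𝓕 φ|² dη` to the circle of length `T`. -/
def circleSpectrum (T : ℝ) (φ : L2R) : Measure (AddCircle T) :=
  (volume.withDensity (energyDensity φ)).map (↑)

instance isFiniteMeasure_circleSpectrum (T : ℝ) (φ : L2R) :
    IsFiniteMeasure (circleSpectrum T φ) := by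
  unfold circleSpectrum; infer_instance

/-- The function `u` has the transform `C · 𝓕 φ` with a periodic factor `C`. -/
def HasPeriodicMultiplier (T : ℝ) (φ u : L2R) (C : AddCircle T → ℂ) : Prop :=
  ((𝓕 u : L2R) : ℝ → ℂ) =ᵐ[volume] fun η => C (η : AddCircle T) * (𝓕 φ : L2R) η

variable {T : ℝ} {φ u v : L2R} {C D : AddCircle T → ℂ}

/-- Plancherel followed by push-forward: a periodic factor measures the same on the line against `|𝓕
φ|²` as on the circle against `circleSpectrum`. -/
theorem HasPeriodicMultiplier.enorm_eq (h : HasPeriodicMultiplier T φ u C) (hC : Measurable C) :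
    ‖u‖ₑ = eLpNorm C 2 (circleSpectrum T φ) := by
  have h2 : ‖u‖ₑ ^ 2 = eLpNorm C 2 (circleSpectrum T φ) ^ 2 := by
    rw [enorm_sq_eq_lintegral_fourier, eLpNorm_two_sq, circleSpectrum,
      lintegral_map (by fun_prop) AddCircle.measurable_mk',
      lintegral_withDensity_eq_lintegral_mul _ (measurable_energyDensity φ)
        (by fun_prop)]
    refine lintegral_congr_ae ?_
    filter_upwards [h] with η hη
    rw [hη, enorm_mul, mul_pow, mul_comm]; rfl
  exact (ENNReal.pow_right_strictMono two_ne_zero).injective h2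

theorem HasPeriodicMultiplier.sub (hu : HasPeriodicMultiplier T φ u C)
    (hv : HasPeriodicMultiplier T φ v D) :
    HasPeriodicMultiplier T φ (u - v) fun q => C q - D q := by
  have h1 : (𝓕 (u - v) : L2R) = 𝓕 u - 𝓕 v := (Lp.fourierTransformₗᵢ ℝ ℂ).map_sub u v
  unfold HasPeriodicMultiplier
  rw [h1]
  filter_upwards [Lp.coeFn_sub (𝓕 u : L2R) (𝓕 v), hu, hv] with η h2 h3 h4
  rw [h2, Pi.sub_apply, h3, h4]; ring

theorem HasPeriodicMultiplier.sum_smul {ι : Type*} {u : ι → L2R} {C : ι → AddCircle T → ℂ}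
    (h : ∀ i, HasPeriodicMultiplier T φ (u i) (C i)) (s : Finset ι) (c : ι → ℂ) :
    HasPeriodicMultiplier T φ (∑ i ∈ s, c i • u i) fun q => ∑ i ∈ s, c i * C i q := by
  classical
  unfold HasPeriodicMultiplier at h ⊢
  induction s using Finset.induction_on with
  | empty =>
    have h1 : (𝓕 (0 : L2R) : L2R) = 0 := (Lp.fourierTransformₗᵢ ℝ ℂ).map_zero
    simp only [Finset.sum_empty, zero_mul, h1]
    exact Lp.coeFn_zero _ _ _
  | insert i s hi ih =>
    have h1 : (𝓕 (c i • u i + ∑ i ∈ s, c i • u i) : L2R) =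
        c i • 𝓕 (u i) + 𝓕 (∑ i ∈ s, c i • u i) := by
      have := (Lp.fourierTransformₗᵢ ℝ ℂ).map_add (c i • u i) (∑ i ∈ s, c i • u i)
      rw [(Lp.fourierTransformₗᵢ ℝ ℂ).map_smul] at this
      exact this
    simp only [Finset.sum_insert hi, h1]
    filter_upwards [Lp.coeFn_add (c i • 𝓕 (u i) : L2R) (𝓕 (∑ i ∈ s, c i • u i)),
      Lp.coeFn_smul (c i) (𝓕 (u i) : L2R), h i, ih] with η h2 h3 h4 h5
    rw [h2, Pi.add_apply, h3, Pi.smul_apply, h4, h5, smul_eq_mul]; ring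

theorem fourierChar_eq_fourier {lam : ℝ} (n : ℤ) (η : ℝ) :
    (Real.fourierChar (-(n * lam * η)) : ℂ) = fourier (-n) (η : AddCircle lam⁻¹) := by
  rw [Real.fourierChar_apply, fourier_coe_apply]
  congr 1
  push_cast
  rw [div_inv_eq_mul]
  ring

theorem HasPeriodicMultiplier.translate {lam : ℝ} {C : AddCircle lam⁻¹ → ℂ}
    (h : HasPeriodicMultiplier lam⁻¹ φ u C) (n : ℤ) :
    HasPeriodicMultiplier lam⁻¹ φ (translate (n * lam) u) fun q => fourier (-n) q * C q := by
  filter_upwards [h, fourier_translate_ae_eq (n * lam) u] with η h1 h2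
  rw [h2, h1, fourierChar_eq_fourier]; ring

theorem hasPeriodicMultiplier_self : HasPeriodicMultiplier T φ φ fun _ => 1 :=
  Eventually.of_forall fun _ => (one_mul _).symm

theorem hasPeriodicMultiplier_translate (lam : ℝ) (φ : L2R) (n : ℤ) :
    HasPeriodicMultiplier lam⁻¹ φ (GenSampling.translate (n * lam) φ) (fourier (-n)) := by
  simpa only [mul_one] using (hasPeriodicMultiplier_self (T := lam⁻¹) (φ := φ)).translate n

/-- The closed linear span of the translates `φ(· - n λ)`. -/
def shiftSpace (φ : L2R) (lam : ℝ) : Submodule ℂ L2R :=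
  (Submodule.span ℂ (Set.range fun n : ℤ => translate (n * lam) φ)).topologicalClosure

/-- By the isometry `HasPeriodicMultiplier.enorm_eq`, approximating `C` by trigonometric polynomials
approximates `u` by finite combinations of translates. `C` need not be bounded. -/
theorem HasPeriodicMultiplier.mem_shiftSpace {lam : ℝ} [Fact (0 < lam⁻¹)]
    {C : AddCircle lam⁻¹ → ℂ} (h : HasPeriodicMultiplier lam⁻¹ φ u C) (hC : Measurable C) :
    u ∈ shiftSpace φ lam := by
  have hL : MemLp C 2 (circleSpectrum lam⁻¹ φ) :=
    ⟨hC.aestronglyMeasurable, by rw [← h.enorm_eq hC]; exact enorm_lt_top⟩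
  refine Metric.mem_closure_iff.2 fun ε hε => ?_
  obtain ⟨s, c, hsc⟩ := exists_trigonometric_eLpNorm_sub_le _ hL (half_pos hε)
  have hm := HasPeriodicMultiplier.sum_smul
    (fun n : ℤ => hasPeriodicMultiplier_translate lam φ (-n)) s c
  simp only [neg_neg] at hm
  refine ⟨∑ n ∈ s, c n • GenSampling.translate ((-n : ℤ) * lam) φ, Submodule.sum_mem _ fun n _ =>
    Submodule.smul_mem _ (c n) (Submodule.subset_span ⟨-n, rfl⟩), ?_⟩
  have hcont : Continuous fun q : AddCircle lam⁻¹ => ∑ n ∈ s, c n * fourier n q := by fun_prop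
  rw [← (h.sub hm).enorm_eq (hC.sub hcont.measurable), ← ofReal_norm,
    ENNReal.ofReal_le_ofReal_iff (half_pos hε).le] at hsc
  rw [dist_eq_norm]
  linarith

/-- The spectral characterization of Riesz sequences of translates. -/
theorem exists_periodization_bounds {lam : ℝ} [hT : Fact (0 < lam⁻¹)]
    (hR : IsRieszBasisOfSpan fun n : ℤ => translate (n * lam) φ) :
    ∃ K : ℝ≥0, ∀ᵐ q : AddCircle lam⁻¹, 1 ≤ K * periodization lam⁻¹ (energyDensity φ) q ∧
      periodization lam⁻¹ (energyDensity φ) q ≤ K := by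
  have hlam : 0 < lam := inv_pos.1 hT.out
  obtain ⟨A, B, hA, hB, hAB⟩ := hR.exists_finset_bounds
  set ν := circleSpectrum lam⁻¹ φ with hν
  set P := periodization lam⁻¹ (energyDensity φ) with hP
  have hPm : Measurable P := measurable_periodization (measurable_energyDensity φ)
  have hνP : ν = volume.withDensity P := map_withDensity_coe (measurable_energyDensity φ)
  have hnorm : ∀ (s : Finset ℤ) (c : ℤ → ℂ),
      eLpNorm (fun q : AddCircle lam⁻¹ => ∑ n ∈ s, c n * fourier n q) 2 ν =
        ‖∑ n ∈ s, c n • translate ((-n : ℤ) * lam) φ‖ₑ := fun s c => by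
    have hm := HasPeriodicMultiplier.sum_smul
      (fun n : ℤ => hasPeriodicMultiplier_translate lam φ (-n)) s c
    simp only [neg_neg] at hm
    have hcont : Continuous fun q : AddCircle lam⁻¹ => ∑ n ∈ s, c n * fourier n q := by fun_prop
    exact (hm.enorm_eq hcont.measurable).symm
  have hb : ∀ (s : Finset ℤ) (c : ℤ → ℂ),
      A * ∑ n ∈ s, ‖c n‖ ^ 2 ≤ ‖∑ n ∈ s, c n • translate ((-n : ℤ) * lam) φ‖ ^ 2 ∧
        ‖∑ n ∈ s, c n • translate ((-n : ℤ) * lam) φ‖ ^ 2 ≤ B * ∑ n ∈ s, ‖c n‖ ^ 2 :=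
    fun s c => by
      have := hAB (s.map (Equiv.neg ℤ).toEmbedding) fun n => c (-n)
      simpa using this
  -- The Riesz bounds compare the `L²` norms of trigonometric polynomials for Haar measure and for
  -- `ν`; they become inequalities of measures, and then, as `ν` has density `P`, bounds on `P`.
  have h1 : ∀ E, MeasurableSet E → AddCircle.haarAddCircle (T := lam⁻¹) E ≤
      (Real.toNNReal (Real.sqrt A⁻¹) : ℝ≥0∞) ^ 2 * ν E := fun E hE => by
    refine measure_le_of_trigonometric _ _ _ (fun s c => ?_) hE
    rw [eLpNorm_trigonometric_haar, hnorm, ← ofReal_norm]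
    show _ ≤ ENNReal.ofReal _ * _
    rw [← ENNReal.ofReal_mul (Real.sqrt_nonneg _)]
    refine ENNReal.ofReal_le_ofReal ?_
    rw [← Real.sqrt_sq (norm_nonneg (∑ n ∈ s, c n • translate ((-n : ℤ) * lam) φ)),
      ← Real.sqrt_mul (inv_pos.2 hA).le]
    refine Real.sqrt_le_sqrt ?_
    rw [le_inv_mul_iff₀ hA]
    exact (hb s c).1
  have h2 : ∀ E, MeasurableSet E → ν E ≤
      (Real.toNNReal (Real.sqrt B) : ℝ≥0∞) ^ 2 * AddCircle.haarAddCircle (T := lam⁻¹) E :=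
    fun E hE => by
    refine measure_le_of_trigonometric _ _ _ (fun s c => ?_) hE
    rw [eLpNorm_trigonometric_haar, hnorm, ← ofReal_norm]
    show _ ≤ ENNReal.ofReal _ * _
    rw [← ENNReal.ofReal_mul (Real.sqrt_nonneg _)]
    refine ENNReal.ofReal_le_ofReal ?_
    rw [← Real.sqrt_sq (norm_nonneg (∑ n ∈ s, c n • translate ((-n : ℤ) * lam) φ)),
      ← Real.sqrt_mul hB.le]
    exact Real.sqrt_le_sqrt (hb s c).2
  have hvol : ∀ E : Set (AddCircle lam⁻¹), volume E =
      ENNReal.ofReal lam⁻¹ * AddCircle.haarAddCircle (T := lam⁻¹) E := fun E => by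
    rw [AddCircle.volume_eq_smul_haarAddCircle]; rfl
  have hvol' : ∀ E : Set (AddCircle lam⁻¹), AddCircle.haarAddCircle (T := lam⁻¹) E =
      ENNReal.ofReal lam * volume E := fun E => by
    rw [hvol, ← mul_assoc, ← ENNReal.ofReal_mul hlam.le, mul_inv_cancel₀ hlam.ne']; simp
  set K₁ : ℝ≥0 := Real.toNNReal lam⁻¹ * Real.toNNReal (Real.sqrt A⁻¹) ^ 2 with hK₁
  set K₂ : ℝ≥0 := Real.toNNReal (Real.sqrt B) ^ 2 * Real.toNNReal lam with hK₂
  have h3 : (1 : AddCircle lam⁻¹ → ℝ≥0∞) ≤ᵐ[volume] fun q => K₁ * P q := by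
    refine ae_le_of_forall_setLIntegral_le_of_sigmaFinite measurable_one fun E hE _ => ?_
    rw [lintegral_const_mul _ hPm, ← withDensity_apply P hE, ← hνP]
    simp only [Pi.one_apply, lintegral_one, Measure.restrict_apply_univ]
    rw [hvol, hK₁]
    push_cast
    rw [mul_assoc]
    exact mul_le_mul_right (h1 E hE) _
  have h4 : P ≤ᵐ[volume] fun _ => (K₂ : ℝ≥0∞) := by
    refine ae_le_of_forall_setLIntegral_le_of_sigmaFinite hPm fun E hE _ => ?_
    rw [← withDensity_apply P hE, ← hνP, lintegral_const, Measure.restrict_apply_univ, hK₂]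
    refine (h2 E hE).trans (le_of_eq ?_)
    push_cast
    rw [hvol', mul_assoc]; rfl
  refine ⟨K₁ + K₂, ?_⟩
  filter_upwards [h3, h4] with q h5 h6
  refine ⟨h5.trans ?_, h6.trans ?_⟩
  · gcongr; exact le_self_add
  · push_cast; exact le_add_self

end SpectralMeasure

/-! ### The norm of the localization space through Plancherel. -/

section LocalizationSpace

open scoped ENNReal NNReal

variable {φ : L2R}

theorem integral_comp_div_two_pi (G : ℝ → ℂ) :
    ∫ ξ : ℝ, G (ξ / (2 * Real.pi)) = ((2 * Real.pi : ℝ) : ℂ) * ∫ η, G η := by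
  rw [Measure.integral_comp_div, abs_of_pos Real.two_pi_pos, Complex.real_smul]

theorem norm_sq_eq_integral_fourier (f : L2R) : ‖f‖ ^ 2 = ∫ η, ‖(𝓕 f : L2R) η‖ ^ 2 := by
  have h1 := inner_L2_eq (𝓕 f) (𝓕 f)
  rw [inner_self_eq_norm_sq_to_K, Lp.norm_fourier_eq] at h1
  have h2 : ∫ η, (𝓕 f : L2R) η * conj ((𝓕 f : L2R) η) =
      ((∫ η, ‖(𝓕 f : L2R) η‖ ^ 2 : ℝ) : ℂ) := by
    rw [← integral_complex_ofReal]
    refine integral_congr_ae (Eventually.of_forall fun η => ?_)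
    simp only [Complex.mul_conj, Complex.normSq_eq_norm_sq]
  rw [h2] at h1
  exact Complex.ofReal_injective (by push_cast at h1 ⊢; exact h1)

theorem integrable_norm_fourier_sq (f : L2R) : Integrable fun η => ‖(𝓕 f : L2R) η‖ ^ 2 :=
  (Lp.memLp (𝓕 f : L2R)).integrable_norm_pow two_ne_zero

theorem exists_hasPeriodicMultiplier {T : ℝ} {C : AddCircle T → ℂ} (hC : Measurable C) {K : ℝ}
    (hK : ∀ᵐ η : ℝ, ‖C (η : AddCircle T)‖ ≤ K) (φ : L2R) :
    ∃ u : L2R, HasPeriodicMultiplier T φ u C := by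
  have hm : MemLp (fun η : ℝ => C (η : AddCircle T) * (𝓕 φ : L2R) η) 2 volume := by
    refine (Lp.memLp (𝓕 φ : L2R)).of_le_mul (c := K)
      ((hC.comp AddCircle.measurable_mk').aestronglyMeasurable.mul (Lp.aestronglyMeasurable _)) ?_
    filter_upwards [hK] with η hη
    rw [norm_mul]
    gcongr
  refine ⟨𝓕⁻ (hm.toLp _), ?_⟩
  rw [HasPeriodicMultiplier, FourierTransform.fourier_fourierInv_eq]
  exact hm.coeFn_toLp

theorem memLp_filteredSpectrum {K : ℝ} (hK : ∀ᵐ η : ℝ, ‖(𝓕 φ : L2R) η‖ ≤ K) (f : L2R) :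
    MemLp (filteredSpectrum φ f) 2 volume := by
  refine (Lp.memLp (𝓕 f : L2R)).of_le_mul (c := K)
    (integrable_filteredSpectrum φ f).aestronglyMeasurable ?_
  filter_upwards [hK] with η hη
  rw [filteredSpectrum, norm_mul, RCLike.norm_conj, mul_comm]
  gcongr

theorem fourierL2_prefilter {K : ℝ} (hK : ∀ᵐ η : ℝ, ‖(𝓕 φ : L2R) η‖ ≤ K) (f : L2R) :
    MemLp (prefilter φ f) 2 volume ∧ fourierL2 (prefilter φ f) =ᵐ[volume] fun ξ =>
      (((Real.sqrt (2 * Real.pi))⁻¹ : ℝ) : ℂ) * filteredSpectrum φ f (ξ / (2 * Real.pi)) := by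
  rw [prefilter_eq_fourierInv]
  exact fourierL2_fourierInv (integrable_filteredSpectrum φ f) (memLp_filteredSpectrum hK f)

theorem support_fourierL2 (φ : L2R) : Function.support (fourierL2 φ) =
    (fun ξ : ℝ => ξ / (2 * Real.pi)) ⁻¹' Function.support (𝓕 φ : L2R) := by
  ext ξ
  have : Real.sqrt (2 * Real.pi) ≠ 0 := by positivity
  simp only [Function.mem_support, fourierL2_coe, Set.mem_preimage, ne_eq, mul_eq_zero,
    Complex.ofReal_eq_zero, inv_eq_zero, this, false_or]

theorem measurableSet_support_fourier (φ : L2R) :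
    MeasurableSet (Function.support (𝓕 φ : L2R)) :=
  measurableSet_support (Lp.stronglyMeasurable (𝓕 φ : L2R)).measurable

theorem measurableSet_support_fourierL2 (φ : L2R) :
    MeasurableSet (Function.support (fourierL2 φ)) := by
  rw [support_fourierL2]
  exact (measurable_id.div_const _) (measurableSet_support_fourier φ)

/-- The energy density of `f` restricted to the spectrum of `φ`. -/
def spectralEnergy (φ f : L2R) : ℝ → ℝ :=
  (Function.support (𝓕 φ : L2R)).indicator fun η => ‖(𝓕 f : L2R) η‖ ^ 2

theorem integrable_spectralEnergy (φ f : L2R) : Integrable (spectralEnergy φ f) :=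
  (integrable_norm_fourier_sq f).indicator (measurableSet_support_fourier φ)

/-- On the spectrum of `φ`, dividing by `|φ̂|²` undoes the filter; the factors `(2π)^{-1/2}` of
numerator and denominator cancel. -/
theorem indicator_fourierL2_prefilter {K : ℝ} (hK : ∀ᵐ η : ℝ, ‖(𝓕 φ : L2R) η‖ ≤ K) (f : L2R) :
    (Function.support (fourierL2 φ)).indicator
      (fun ξ => ‖fourierL2 (prefilter φ f) ξ‖ ^ 2 * (‖fourierL2 φ ξ‖ ^ 2)⁻¹) =ᵐ[volume]
      fun ξ => spectralEnergy φ f (ξ / (2 * Real.pi)) := by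
  filter_upwards [(fourierL2_prefilter hK f).2] with ξ hξ
  have hs : ‖(((Real.sqrt (2 * Real.pi))⁻¹ : ℝ) : ℂ)‖ ≠ 0 := by
    rw [norm_ne_zero_iff, Complex.ofReal_ne_zero]; positivity
  by_cases h : (𝓕 φ : L2R) (ξ / (2 * Real.pi)) = 0
  · rw [Set.indicator_of_notMem, spectralEnergy, Set.indicator_of_notMem]
    · simpa using h
    · rw [support_fourierL2]; simpa using h
  · rw [Set.indicator_of_mem, spectralEnergy, Set.indicator_of_mem]
    · rw [hξ, fourierL2_coe, filteredSpectrum]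
      have h' : ‖(𝓕 φ : L2R) (ξ / (2 * Real.pi))‖ ≠ 0 := norm_ne_zero_iff.2 h
      simp only [norm_mul, RCLike.norm_conj]
      field_simp
    · exact h
    · rw [support_fourierL2]; exact h

theorem integrableOn_locSpace {K : ℝ} (hK : ∀ᵐ η : ℝ, ‖(𝓕 φ : L2R) η‖ ≤ K) (f : L2R) :
    IntegrableOn (fun ξ : ℝ => ‖fourierL2 (prefilter φ f) ξ‖ ^ 2 * (‖fourierL2 φ ξ‖ ^ 2)⁻¹)
      (Function.support (fourierL2 φ)) := by
  rw [← integrable_indicator_iff (measurableSet_support_fourierL2 φ),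
    integrable_congr (indicator_fourierL2_prefilter hK f)]
  exact (integrable_spectralEnergy φ f).comp_div Real.two_pi_pos.ne'

theorem locNorm_prefilter {K : ℝ} (hK : ∀ᵐ η : ℝ, ‖(𝓕 φ : L2R) η‖ ≤ K) (f : L2R) :
    locNorm φ (prefilter φ f) = Real.sqrt (∫ η, spectralEnergy φ f η) := by
  have h1 : locInner φ (prefilter φ f) (prefilter φ f) = ((∫ η, spectralEnergy φ f η : ℝ) : ℂ) := by
    rw [locInner, ← integral_indicator (measurableSet_support_fourierL2 φ),
      integral_congr_ae (g := fun ξ => ((spectralEnergy φ f (ξ / (2 * Real.pi)) : ℝ) : ℂ)),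
      integral_comp_div_two_pi fun η => ((spectralEnergy φ f η : ℝ) : ℂ), ← mul_assoc,
      inv_mul_cancel₀ (Complex.ofReal_ne_zero.2 Real.two_pi_pos.ne'), one_mul,
      integral_complex_ofReal]
    filter_upwards [indicator_fourierL2_prefilter hK f] with ξ hξ
    rw [← hξ]
    by_cases h : ξ ∈ Function.support (fourierL2 φ)
    · rw [Set.indicator_of_mem h, Set.indicator_of_mem h, Complex.mul_conj,
        Complex.normSq_eq_norm_sq]
      push_cast; rfl
    · rw [Set.indicator_of_notMem h, Set.indicator_of_notMem h, Complex.ofReal_zero]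
  rw [locNorm, h1, Complex.ofReal_re]

theorem locNorm_prefilter_le {K : ℝ} (hK : ∀ᵐ η : ℝ, ‖(𝓕 φ : L2R) η‖ ≤ K) (f : L2R) :
    locNorm φ (prefilter φ f) ≤ ‖f‖ := by
  rw [locNorm_prefilter hK, Real.sqrt_le_left (norm_nonneg _), norm_sq_eq_integral_fourier]
  refine integral_mono (integrable_spectralEnergy φ f) (integrable_norm_fourier_sq f) fun η => ?_
  exact Set.indicator_le_self' (fun _ _ => by positivity) η

/-- Every element of the localization space has a preimage under the prefilter of the same norm. -/
theorem exists_prefilter_eq_norm_eq {K : ℝ} (hK : ∀ᵐ η : ℝ, ‖(𝓕 φ : L2R) η‖ ≤ K) (f : L2R) :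
    ∃ f₁ : L2R, prefilter φ f₁ = prefilter φ f ∧ ‖f₁‖ = locNorm φ (prefilter φ f) := by
  -- The preimage of least norm: frequencies where `𝓕 φ` vanishes do not affect the filtered signal,
  -- so they are cut off.
  have hm : MemLp ((Function.support (𝓕 φ : L2R)).indicator (𝓕 f : L2R)) 2 volume :=
    (Lp.memLp (𝓕 f : L2R)).indicator (measurableSet_support_fourier φ)
  have hF : ((𝓕 (𝓕⁻ (hm.toLp _)) : L2R) : ℝ → ℂ) =ᵐ[volume]
      (Function.support (𝓕 φ : L2R)).indicator (𝓕 f : L2R) := by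
    rw [FourierTransform.fourier_fourierInv_eq]; exact hm.coeFn_toLp
  refine ⟨𝓕⁻ (hm.toLp _), ?_, ?_⟩
  · rw [prefilter_eq_fourierInv, prefilter_eq_fourierInv]
    funext x
    rw [Real.fourierInv_eq, Real.fourierInv_eq]
    refine integral_congr_ae ?_
    filter_upwards [hF] with η hη
    rw [filteredSpectrum, hη, filteredSpectrum]
    by_cases h : (𝓕 φ : L2R) η = 0
    · simp [h]
    · rw [Set.indicator_of_mem (show η ∈ Function.support (𝓕 φ : L2R) from h)]
  · rw [locNorm_prefilter hK, ← Real.sqrt_sq (norm_nonneg _), norm_sq_eq_integral_fourier]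
    congr 1
    refine integral_congr_ae ?_
    filter_upwards [hF] with η hη
    rw [hη, spectralEnergy]
    by_cases h : η ∈ Function.support (𝓕 φ : L2R)
    · rw [Set.indicator_of_mem h, Set.indicator_of_mem h]
    · rw [Set.indicator_of_notMem h, Set.indicator_of_notMem h]; simp

/-- The prefilter commutes with translations and is a contraction into the localization norm, so
approximation by translates of `φ` carries over to translates of `Φ`. -/
theorem prefilter_mem_recSpace {K : ℝ} (hK : ∀ᵐ η : ℝ, ‖(𝓕 φ : L2R) η‖ ≤ K) {lam : ℝ} {f : L2R}
    (hf : f ∈ shiftSpace φ lam) : prefilter φ f ∈ recSpace φ lam := by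
  refine ⟨⟨f, rfl⟩, fun ε hε => ?_⟩
  obtain ⟨u, hu, hfu⟩ := Metric.mem_closure_iff.1 hf ε hε
  refine ⟨prefilter φ u, ?_, ?_⟩
  · have h1 : prefilterₗ φ u ∈ Submodule.map (prefilterₗ φ)
        (Submodule.span ℂ (Set.range fun n : ℤ => translate (n * lam) φ)) :=
      Submodule.mem_map_of_mem hu
    rw [Submodule.map_span, ← Set.range_comp] at h1
    have h2 : (fun (n : ℤ) (x : ℝ) => autocorr φ (x - n * lam)) =
        prefilterₗ φ ∘ fun n : ℤ => translate (n * lam) φ := by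
      funext n x
      exact (prefilter_translate φ φ (n * lam) x).symm
    rw [h2]
    exact h1
  · rw [← prefilterₗ_apply, ← prefilterₗ_apply, ← map_sub, prefilterₗ_apply]
    rw [dist_eq_norm] at hfu
    exact (locNorm_prefilter_le hK _).trans_lt hfu

end LocalizationSpace

/-! ### The dual generator and biorthogonality. -/

section DualGenerator

open scoped ENNReal NNReal

variable {φ ψ : L2R} {lam : ℝ}

/-- The periodic factor `λ / ∑ₙ |𝓕 φ(η + n / λ)|²` defining the dual generator. -/
def dualMultiplier (φ : L2R) (lam : ℝ) (q : AddCircle lam⁻¹) : ℂ :=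
  ((lam * (periodization lam⁻¹ (energyDensity φ) q).toReal⁻¹ : ℝ) : ℂ)

theorem measurable_dualMultiplier : Measurable (dualMultiplier φ lam) := by
  have := measurable_periodization (T := lam⁻¹) (measurable_energyDensity φ)
  unfold dualMultiplier
  fun_prop

variable [hT : Fact (0 < lam⁻¹)]

theorem exists_norm_fourier_le (hR : IsRieszBasisOfSpan fun n : ℤ => translate (n * lam) φ) :
    ∃ K : ℝ, ∀ᵐ η : ℝ, ‖(𝓕 φ : L2R) η‖ ≤ K := by
  obtain ⟨K, hK⟩ := exists_periodization_bounds hR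
  refine ⟨Real.sqrt K, ?_⟩
  filter_upwards [quasiMeasurePreserving_coe.ae hK] with η hη
  have h1 : energyDensity φ η ≤ K := by
    refine le_trans ?_ hη.2
    rw [periodization_coe]
    have := ENNReal.le_tsum (f := fun n : ℤ => energyDensity φ (η + n * lam⁻¹)) 0
    simpa using this
  refine Real.le_sqrt_of_sq_le ?_
  rw [energyDensity, ← ofReal_norm, ← ENNReal.ofReal_pow (norm_nonneg _),
    ← ENNReal.ofReal_coe_nnreal, ENNReal.ofReal_le_ofReal_iff K.coe_nonneg] at h1
  exact h1

/-- The lower bound on the periodization keeps the multiplier bounded, so the product with `𝓕 φ`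
stays in `L²`. -/
theorem exists_dualGenerator (hR : IsRieszBasisOfSpan fun n : ℤ => translate (n * lam) φ) :
    ∃ ψ : L2R, HasPeriodicMultiplier lam⁻¹ φ ψ (dualMultiplier φ lam) := by
  obtain ⟨K, hK⟩ := exists_periodization_bounds hR
  have hlam : 0 < lam := inv_pos.1 hT.out
  refine exists_hasPeriodicMultiplier measurable_dualMultiplier (K := lam * K) ?_ φ
  filter_upwards [quasiMeasurePreserving_coe.ae hK] with η hη
  have hfin := (hη.2.trans_lt ENNReal.coe_lt_top).ne
  have h1 : 1 ≤ (K : ℝ) * (periodization lam⁻¹ (energyDensity φ) (η : AddCircle lam⁻¹)).toReal := by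
    have := ENNReal.toReal_mono (ENNReal.mul_ne_top ENNReal.coe_ne_top hfin) hη.1
    simpa using this
  have h0 : 0 < (periodization lam⁻¹ (energyDensity φ) (η : AddCircle lam⁻¹)).toReal := by
    by_contra h0
    nlinarith [K.coe_nonneg]
  rw [dualMultiplier, Complex.norm_real, Real.norm_of_nonneg (by positivity)]
  gcongr
  rwa [inv_le_iff_one_le_mul₀ h0]

theorem integral_fourier_haar (k : ℤ) :
    ∫ q : AddCircle lam⁻¹, fourier k q ∂AddCircle.haarAddCircle = if k = 0 then 1 else 0 := by
  have := congrFun (fourierCoeff_fourier (T := lam⁻¹) k) 0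
  simpa [fourierCoeff, Pi.single_apply, eq_comm] using this

/-- On the circle the density `P` cancels the denominator of the multiplier. What remains is `λ`
times the integral of a character over a circle of length `λ⁻¹`. -/
theorem inner_translate_dualGenerator
    (hR : IsRieszBasisOfSpan fun n : ℤ => translate (n * lam) φ)
    (hψ : HasPeriodicMultiplier lam⁻¹ φ ψ (dualMultiplier φ lam)) (m n : ℤ) :
    inner ℂ (translate (m * lam) φ) (translate (n * lam) ψ) = if m = n then (1 : ℂ) else 0 := by
  obtain ⟨K, hK⟩ := exists_periodization_bounds hR
  have hlam : 0 < lam := inv_pos.1 hT.out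
  set P := periodization lam⁻¹ (energyDensity φ) with hP
  have hPm : Measurable P := measurable_periodization (measurable_energyDensity φ)
  have hF : Measurable fun q : AddCircle lam⁻¹ => fourier (m - n) q * dualMultiplier φ lam q :=
    (fourier (m - n)).continuous.measurable.mul measurable_dualMultiplier
  have h1 : inner ℂ (translate (m * lam) φ) (translate (n * lam) ψ) =
      ∫ η : ℝ, (energyDensity φ η).toReal •
        (fourier (m - n) (η : AddCircle lam⁻¹) * dualMultiplier φ lam (η : AddCircle lam⁻¹)) := by
    rw [← Lp.inner_fourier_eq, inner_L2_eq]
    refine integral_congr_ae ?_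
    filter_upwards [hasPeriodicMultiplier_translate lam φ m, hψ.translate n] with η h1 h2
    rw [h1, h2, map_mul, ← fourier_neg, neg_neg, sub_eq_neg_add, fourier_add, energyDensity,
      ENNReal.toReal_pow, toReal_enorm, Complex.real_smul, ← Complex.normSq_eq_norm_sq,
      ← Complex.mul_conj]
    ring
  rw [h1, ← integral_withDensity_eq_integral_toReal_smul (measurable_energyDensity φ)
      (Eventually.of_forall fun η => by simp [energyDensity]),
    ← integral_map (μ := volume.withDensity (energyDensity φ))
      (f := fun q : AddCircle lam⁻¹ => fourier (m - n) q * dualMultiplier φ lam q)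
      AddCircle.measurable_mk'.aemeasurable hF.aestronglyMeasurable,
    map_withDensity_coe (measurable_energyDensity φ),
    integral_withDensity_eq_integral_toReal_smul hPm
      (hK.mono fun q hq => hq.2.trans_lt ENNReal.coe_lt_top)]
  have h2 : ∫ q : AddCircle lam⁻¹, (P q).toReal • (fourier (m - n) q * dualMultiplier φ lam q) =
      ∫ q : AddCircle lam⁻¹, (lam : ℂ) * fourier (m - n) q := by
    refine integral_congr_ae ?_
    filter_upwards [hK] with q hq
    have h0 : (P q).toReal ≠ 0 := by
      refine ENNReal.toReal_ne_zero.2 ⟨fun h => ?_, (hq.2.trans_lt ENNReal.coe_lt_top).ne⟩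
      have := hq.1
      rw [h] at this
      simp at this
    rw [dualMultiplier, Complex.real_smul, ← hP]
    push_cast
    have h0' : ((P q).toReal : ℂ) ≠ 0 := Complex.ofReal_ne_zero.2 h0
    field_simp
  have h3 := AddCircle.integral_haarAddCircle (T := lam⁻¹)
    (f := fun q => fourier (m - n) q)
  rw [integral_fourier_haar, inv_inv, Complex.real_smul] at h3
  rw [h2, integral_const_mul, ← h3]
  simp only [sub_eq_zero]

end DualGenerator

/-! ### The interpolating function as a filtered dual generator. -/

section Interpolation

open scoped ENNReal NNReal

variable {φ ψ : L2R} {lam : ℝ} [hT : Fact (0 < lam⁻¹)]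

/-- The spectrum of `Φ` is a multiple of `|𝓕 φ|²`, so the denominator is the periodization over `λ`,
which is finite and positive almost everywhere. -/
theorem summable_and_interpDenom_eq
    (hR : IsRieszBasisOfSpan fun n : ℤ => translate (n * lam) φ) :
    ∀ᵐ ξ : ℝ, Summable (fun n : ℤ => fourierL2 (autocorr φ) (ξ + n * (2 * Real.pi / lam))) ∧
      interpDenom φ lam ξ = (((periodization lam⁻¹ (energyDensity φ)
        ((ξ / (2 * Real.pi) : ℝ) : AddCircle lam⁻¹)).toReal / lam : ℝ) : ℂ) ∧
      interpDenom φ lam ξ ≠ 0 := by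
  obtain ⟨K, hK⟩ := exists_periodization_bounds hR
  obtain ⟨K', hK'⟩ := exists_norm_fourier_le hR
  have hlam : 0 < lam := inv_pos.1 hT.out
  have h1 : ∀ᵐ ξ : ℝ, ∀ n : ℤ, fourierL2 (autocorr φ) (ξ + n * (2 * Real.pi / lam)) =
      (((Real.sqrt (2 * Real.pi))⁻¹ *
        (energyDensity φ (ξ / (2 * Real.pi) + n * lam⁻¹)).toReal : ℝ) : ℂ) := by
    refine ae_all_iff.2 fun n => ?_
    filter_upwards [(measurePreserving_add_right volume
      (n * (2 * Real.pi / lam))).quasiMeasurePreserving.ae (fourierL2_prefilter hK' φ).2] with ξ hξ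
    have h2 : (ξ + n * (2 * Real.pi / lam)) / (2 * Real.pi) =
        ξ / (2 * Real.pi) + n * lam⁻¹ := by
      field_simp
    rw [autocorr, hξ, filteredSpectrum, h2, Complex.mul_conj, Complex.normSq_eq_norm_sq,
      energyDensity, ENNReal.toReal_pow, toReal_enorm]
    push_cast; rfl
  filter_upwards [h1, (quasiMeasurePreserving_coe.comp quasiMeasurePreserving_div_two_pi).ae hK]
    with ξ h2 h3
  simp only [Function.comp_apply] at h3
  have hfin := (h3.2.trans_lt ENNReal.coe_lt_top).ne
  rw [periodization_coe] at h3 hfin ⊢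
  have hsum := ENNReal.summable_toReal hfin
  have hpos : (∑' n : ℤ, energyDensity φ (ξ / (2 * Real.pi) + n * lam⁻¹)).toReal ≠ 0 := by
    refine ENNReal.toReal_ne_zero.2 ⟨fun h => ?_, hfin⟩
    have := h3.1
    rw [h] at this
    simp at this
  have hD : interpDenom φ lam ξ =
      (((∑' n : ℤ, energyDensity φ (ξ / (2 * Real.pi) + n * lam⁻¹)).toReal / lam : ℝ) : ℂ) := by
    rw [interpDenom, tsum_congr h2, ← Complex.ofReal_tsum, ← Complex.ofReal_mul, tsum_mul_left,
      ENNReal.tsum_toReal_eq fun n => ENNReal.ne_top_of_tsum_ne_top hfin n]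
    congr 1
    have h4 : Real.sqrt (2 * Real.pi) * Real.sqrt (2 * Real.pi) = 2 * Real.pi :=
      Real.mul_self_sqrt Real.two_pi_pos.le
    have h5 : Real.sqrt (2 * Real.pi) ≠ 0 := by positivity
    field_simp
    rw [Real.sq_sqrt Real.two_pi_pos.le]
  refine ⟨?_, hD, ?_⟩
  · simp only [h2]
    exact Complex.ofRealCLM.summable (hsum.mul_left _)
  · rw [hD, Complex.ofReal_ne_zero]
    exact div_ne_zero hpos hlam.ne'

theorem interpHat_ae_eq (hR : IsRieszBasisOfSpan fun n : ℤ => translate (n * lam) φ)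
    (hψ : HasPeriodicMultiplier lam⁻¹ φ ψ (dualMultiplier φ lam)) :
    interpHat φ lam =ᵐ[volume] fun ξ =>
      (((Real.sqrt (2 * Real.pi))⁻¹ : ℝ) : ℂ) * filteredSpectrum φ ψ (ξ / (2 * Real.pi)) := by
  obtain ⟨K', hK'⟩ := exists_norm_fourier_le hR
  filter_upwards [summable_and_interpDenom_eq hR, (fourierL2_prefilter hK' φ).2,
    quasiMeasurePreserving_div_two_pi.ae hψ] with ξ h1 h2 h3
  rw [interpHat, h1.2.1, autocorr, h2, filteredSpectrum, filteredSpectrum, h3, dualMultiplier]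
  push_cast
  rw [div_div_eq_mul_div, div_eq_mul_inv]
  ring

theorem interp_eq_prefilter (hR : IsRieszBasisOfSpan fun n : ℤ => translate (n * lam) φ)
    (hψ : HasPeriodicMultiplier lam⁻¹ φ ψ (dualMultiplier φ lam)) :
    interp φ lam = prefilter φ ψ := by
  funext x
  obtain ⟨G, hG⟩ : ∃ G : ℝ → ℂ, G = fun η : ℝ => (((Real.sqrt (2 * Real.pi))⁻¹ : ℝ) : ℂ) *
    ((Real.fourierChar (η * x) : ℂ) * filteredSpectrum φ ψ η) := ⟨_, rfl⟩
  rw [interp, prefilter_eq_fourierInv, Real.fourierInv_eq,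
    integral_congr_ae (g := fun ξ : ℝ => G (ξ / (2 * Real.pi))),
    integral_comp_div_two_pi, hG, integral_const_mul, ← mul_assoc, ← mul_assoc,
    ← Complex.ofReal_mul, ← Complex.ofReal_mul]
  · have h4 : (Real.sqrt (2 * Real.pi))⁻¹ * (2 * Real.pi) * (Real.sqrt (2 * Real.pi))⁻¹ = 1 := by
      have h5 : Real.sqrt (2 * Real.pi) ≠ 0 := by positivity
      field_simp
      rw [Real.sq_sqrt Real.two_pi_pos.le]
    rw [h4, Complex.ofReal_one, one_mul]
    refine integral_congr_ae (Eventually.of_forall fun η => ?_)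
    simp only [RCLike.inner_apply, conj_trivial, Circle.smul_def, smul_eq_mul, mul_comm x η]
  · filter_upwards [interpHat_ae_eq hR hψ] with ξ hξ
    rw [hξ, hG]
    beta_reduce
    rw [Real.fourierChar_apply]
    have h6 : ((2 * Real.pi * (ξ / (2 * Real.pi) * x) : ℝ) : ℂ) * Complex.I =
        Complex.I * ((x * ξ : ℝ) : ℂ) := by
      rw [mul_comm Complex.I]
      congr 2
      field_simp
    rw [h6]
    ring

theorem integrable_interpHat (hR : IsRieszBasisOfSpan fun n : ℤ => translate (n * lam) φ)
    (hψ : HasPeriodicMultiplier lam⁻¹ φ ψ (dualMultiplier φ lam)) :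
    Integrable (interpHat φ lam) := by
  rw [integrable_congr (interpHat_ae_eq hR hψ)]
  exact ((integrable_filteredSpectrum φ ψ).comp_div Real.two_pi_pos.ne').const_mul _

/-- Samples are pairings with translates of `φ`, and shifts of `Φ_int` are filtered shifts of `ψ`,
so partial sums correspond before and after filtering. -/
theorem partialSeries_eq_prefilter (hR : IsRieszBasisOfSpan fun n : ℤ => translate (n * lam) φ)
    (hψ : HasPeriodicMultiplier lam⁻¹ φ ψ (dualMultiplier φ lam)) (f : L2R) (s : Finset ℤ) :
    partialSeries φ lam (prefilter φ f) s = prefilter φ (∑ n ∈ s,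
      inner ℂ (translate (n * lam) φ) f • translate (n * lam) ψ) := by
  funext x
  rw [partialSeries, ← prefilterₗ_apply φ (∑ n ∈ s, _), map_sum, Finset.sum_apply]
  refine Finset.sum_congr rfl fun n _ => ?_
  rw [map_smul, Pi.smul_apply, prefilterₗ_apply, prefilter_translate, interp_eq_prefilter hR hψ,
    prefilter_eq_inner φ f, smul_eq_mul]

end Interpolation

/-! ### The weighted error estimate. -/

section ErrorBound

open scoped ENNReal NNReal

variable {φ : L2R} {w : ℝ → ℝ} {lam : ℝ}

theorem integrable_weight_mul (hint : Integrable fun ξ : ℝ => w |ξ| * ‖fourierL2 φ ξ‖ ^ 2) :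
    Integrable fun η : ℝ => w (2 * Real.pi * |η|) * ‖(𝓕 φ : L2R) η‖ ^ 2 := by
  have h1 := (hint.comp_mul_left' Real.two_pi_pos.ne').const_mul (2 * Real.pi)
  refine h1.congr (Eventually.of_forall fun η => ?_)
  have h5 : Real.sqrt (2 * Real.pi) ≠ 0 := by positivity
  simp only [fourierL2_coe, norm_mul, Complex.norm_real, abs_mul, abs_of_pos Real.two_pi_pos,
    mul_div_cancel_left₀ _ Real.two_pi_pos.ne', Real.norm_eq_abs, abs_inv,
    abs_of_nonneg (Real.sqrt_nonneg _), mul_pow, inv_pow, Real.sq_sqrt Real.two_pi_pos.le]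
  field_simp

theorem moment_eq_integral (w : ℝ → ℝ) (φ : L2R) :
    moment w φ = ∫ η : ℝ, w (2 * Real.pi * |η|) * ‖(𝓕 φ : L2R) η‖ ^ 2 := by
  obtain ⟨G, hG⟩ : ∃ G : ℝ → ℝ, G = fun η : ℝ => (2 * Real.pi)⁻¹ *
      (w (2 * Real.pi * |η|) * ‖(𝓕 φ : L2R) η‖ ^ 2) := ⟨_, rfl⟩
  have h1 : moment w φ = ∫ ξ : ℝ, G (ξ / (2 * Real.pi)) := by
    refine integral_congr_ae (Eventually.of_forall fun ξ => ?_)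
    simp only [hG, fourierL2_coe, norm_mul, Complex.norm_real, abs_div, abs_of_pos Real.two_pi_pos,
      mul_div_cancel₀ _ Real.two_pi_pos.ne', Real.norm_eq_abs, abs_inv,
      abs_of_nonneg (Real.sqrt_nonneg _), mul_pow, inv_pow, Real.sq_sqrt Real.two_pi_pos.le]
    ring
  rw [h1, Measure.integral_comp_div, abs_of_pos Real.two_pi_pos, hG, integral_const_mul, smul_eq_mul,
    mul_inv_cancel_left₀ Real.two_pi_pos.ne']

/-- A translate of `φ` is approximated in the shift-invariant space by periodizing the
exponential from the fundamental frequency interval. -/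
theorem exists_mem_shiftSpace_norm_sub_sq_le [hT : Fact (0 < lam⁻¹)]
    (hw : ∀ ξ : ℝ, 0 < ξ → 0 < w ξ) (hmono : MonotoneOn w (Set.Ioi 0))
    (hint : Integrable fun ξ : ℝ => w |ξ| * ‖fourierL2 φ ξ‖ ^ 2) (x : ℝ) :
    ∃ v ∈ shiftSpace φ lam,
      ‖translate x φ - v‖ ^ 2 ≤ 4 * moment w φ * (1 / w (Real.pi / lam)) := by
  have hlam : 0 < lam := inv_pos.1 hT.out
  have hw0 := hw (Real.pi / lam) (by positivity)
  set e : ℝ → ℂ := fun η => (Real.fourierChar (-(x * η)) : ℂ) with he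
  have hem : Measurable e := by
    have : Continuous e := by
      rw [he]
      exact continuous_subtype_val.comp (Real.continuous_fourierChar.comp (by fun_prop))
    exact this.measurable
  -- The exponential on the interval `(-1/(2λ), 1/(2λ)]`, continued periodically.
  set C : AddCircle lam⁻¹ → ℂ := AddCircle.liftIoc lam⁻¹ (-(lam⁻¹ / 2)) e with hC
  have hCm : Measurable C := (hem.comp measurable_subtype_coe).comp
    (AddCircle.measurableEquivIoc lam⁻¹ (-(lam⁻¹ / 2))).measurable
  have hC1 : ∀ q, ‖C q‖ = 1 := fun q => Circle.norm_coe _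
  obtain ⟨v, hv⟩ := exists_hasPeriodicMultiplier hCm
    (Eventually.of_forall fun η : ℝ => (hC1 (η : AddCircle lam⁻¹)).le) φ
  refine ⟨v, hv.mem_shiftSpace hCm, ?_⟩
  have hsub : (𝓕 (translate x φ - v) : L2R) = 𝓕 (translate x φ) - 𝓕 v :=
    (Lp.fourierTransformₗᵢ ℝ ℂ).map_sub _ _
  -- Nothing is assumed about `w` at 0.
  have hne : ∀ᵐ η : ℝ, η ≠ 0 := by simp [ae_iff]
  rw [norm_sq_eq_integral_fourier, hsub, moment_eq_integral, mul_right_comm,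
    ← integral_const_mul]
  refine integral_mono_ae (hsub ▸ integrable_norm_fourier_sq (translate x φ - v))
    ((integrable_weight_mul hint).const_mul _) ?_
  filter_upwards [Lp.coeFn_sub (𝓕 (translate x φ) : L2R) (𝓕 v), fourier_translate_ae_eq x φ, hv,
    hne] with η h1 h2 h3 h4
  rw [h1, Pi.sub_apply, h2, h3, ← sub_mul, norm_mul, mul_pow]
  have hη : 0 < 2 * Real.pi * |η| := by positivity
  have hwη := hw _ hη
  -- The multipliers agree inside the interval. Outside they differ by at most 2, giving the
  -- constant 4, and monotonicity bounds the weight ratio below by 1.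
  by_cases hmem : η ∈ Set.Ioc (-(lam⁻¹ / 2)) (-(lam⁻¹ / 2) + lam⁻¹)
  · rw [hC, AddCircle.liftIoc_coe_apply hmem, sub_self, norm_zero, zero_pow two_ne_zero, zero_mul]
    positivity
  · have habs : lam⁻¹ / 2 ≤ |η| := by
      by_contra hlt
      push Not at hlt
      rw [abs_lt] at hlt
      exact hmem ⟨hlt.1, by linarith [hlt.2]⟩
    have hle : w (Real.pi / lam) ≤ w (2 * Real.pi * |η|) := by
      refine hmono (Set.mem_Ioi.2 (by positivity)) hη ?_
      calc Real.pi / lam = 2 * Real.pi * (lam⁻¹ / 2) := by ring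
        _ ≤ 2 * Real.pi * |η| := by gcongr
    have h5 : ‖(Real.fourierChar (-(x * η)) : ℂ) - C (η : AddCircle lam⁻¹)‖ ^ 2 ≤ 4 := by
      have := norm_sub_le (Real.fourierChar (-(x * η)) : ℂ) (C (η : AddCircle lam⁻¹))
      rw [hC1, Circle.norm_coe] at this
      nlinarith [norm_nonneg ((Real.fourierChar (-(x * η)) : ℂ) - C (η : AddCircle lam⁻¹))]
    calc _ ≤ 4 * ‖(𝓕 φ : L2R) η‖ ^ 2 := by gcongr
      _ ≤ 4 * (w (2 * Real.pi * |η|) / w (Real.pi / lam)) * ‖(𝓕 φ : L2R) η‖ ^ 2 := by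
          gcongr
          exact le_mul_of_one_le_right (by norm_num) ((one_le_div hw0).2 hle)
      _ = _ := by ring

theorem summable_one_div_weight (hlam : 0 < lam)
    (hw : ∀ ξ : ℝ, 0 < ξ → 0 < w ξ)
    (hgrowth : ∃ c ε : ℝ, 0 < c ∧ 0 < ε ∧ ∀ ξ : ℝ, 1 ≤ ξ → c * ξ ^ (1 + ε) ≤ w ξ) :
    Summable fun n : ℕ => 1 / w ((2 * (n + 1 : ℝ) - 1) * Real.pi / lam) := by
  obtain ⟨c, ε, hc, hε, h⟩ := hgrowth
  have hsum : Summable fun n : ℕ => (c * (Real.pi / lam) ^ (1 + ε))⁻¹ *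
      (1 / ((n + 1 : ℕ) : ℝ) ^ (1 + ε)) :=
    ((summable_nat_add_iff 1).2 (Real.summable_one_div_nat_rpow.2 (by linarith))).mul_left _
  -- The growth condition holds only from 1 on; `n ≥ λ/π` brings the argument there.
  obtain ⟨N, hN⟩ := exists_nat_ge (lam / Real.pi)
  refine hsum.of_norm_bounded_eventually_nat ?_
  filter_upwards [eventually_ge_atTop N] with n hn
  have hpl : 0 < Real.pi / lam := by positivity
  have hn0 : (0 : ℝ) ≤ n := n.cast_nonneg
  have hn' : lam / Real.pi ≤ n := hN.trans (by exact_mod_cast hn)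
  have harg : (n + 1 : ℝ) * (Real.pi / lam) ≤ (2 * (n + 1 : ℝ) - 1) * Real.pi / lam := by
    rw [mul_div_assoc]
    gcongr
    linarith
  have h1 : 1 ≤ (n + 1 : ℝ) * (Real.pi / lam) := by
    calc (1 : ℝ) = lam / Real.pi * (Real.pi / lam) := by field_simp
      _ ≤ (n + 1 : ℝ) * (Real.pi / lam) := by gcongr; linarith
  have h2 := h _ (h1.trans harg)
  have h3 : c * (Real.pi / lam) ^ (1 + ε) * ((n + 1 : ℕ) : ℝ) ^ (1 + ε) ≤
      w ((2 * (n + 1 : ℝ) - 1) * Real.pi / lam) := by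
    refine le_trans ?_ h2
    rw [mul_assoc, ← Real.mul_rpow hpl.le (by positivity), mul_comm (Real.pi / lam)]
    push_cast
    gcongr
  have hwpos := hw ((2 * (n + 1 : ℝ) - 1) * Real.pi / lam) (by linarith)
  rw [Real.norm_of_nonneg (by positivity), ← one_div, one_div_mul_one_div]
  exact one_div_le_one_div_of_le (by positivity) h3

/-- The part of `f` orthogonal to the shift-invariant space is small after filtering. -/
theorem norm_prefilter_sub_starProjection_sq_le [hT : Fact (0 < lam⁻¹)]
    (hw : ∀ ξ : ℝ, 0 < ξ → 0 < w ξ) (hmono : MonotoneOn w (Set.Ioi 0))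
    (hint : Integrable fun ξ : ℝ => w |ξ| * ‖fourierL2 φ ξ‖ ^ 2) (f : L2R) (x : ℝ)
    [(shiftSpace φ lam).HasOrthogonalProjection] :
    ‖prefilter φ f x - prefilter φ ((shiftSpace φ lam).starProjection f) x‖ ^ 2 ≤
      4 * moment w φ * (1 / w (Real.pi / lam)) * ‖f‖ ^ 2 := by
  obtain ⟨v, hv, hle⟩ :=
    exists_mem_shiftSpace_norm_sub_sq_le (lam := lam) hw hmono hint x
  have h1 : inner ℂ v (f - (shiftSpace φ lam).starProjection f) = 0 := by
    rw [inner_eq_zero_symm]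
    exact Submodule.starProjection_inner_eq_zero _ _ hv
  have h2 : ‖f - (shiftSpace φ lam).starProjection f‖ ≤ ‖f‖ := by
    have h := Submodule.norm_sq_eq_add_norm_sq_starProjection f (shiftSpace φ lam)
    rw [Submodule.starProjection_orthogonal'] at h
    refine le_of_sq_le_sq ?_ (norm_nonneg _)
    have h3 : (1 - (shiftSpace φ lam).starProjection) f =
      f - (shiftSpace φ lam).starProjection f := rfl
    rw [h3] at h
    nlinarith [sq_nonneg ‖(shiftSpace φ lam).starProjection f‖]
  -- Subtracting the vanishing pairing with `v` replaces the translate by its small remainder.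
  rw [prefilter_eq_inner, prefilter_eq_inner, ← inner_sub_right,
    ← sub_zero (inner ℂ (translate x φ) _), ← h1, ← inner_sub_left]
  calc _ ≤ (‖translate x φ - v‖ * ‖f - (shiftSpace φ lam).starProjection f‖) ^ 2 := by
        gcongr; exact norm_inner_le_norm _ _
    _ = ‖translate x φ - v‖ ^ 2 * ‖f - (shiftSpace φ lam).starProjection f‖ ^ 2 := by ring
    _ ≤ _ := by
        gcongr
        exact (sq_nonneg _).trans hle

end ErrorBound

end GenSampling

end

/-! ### Assembly of the sampling theorem. -/

open GenSampling in
theorem theorem3 (φ : L2R) (w : ℝ → ℝ) (S : Set ℝ) (hφ : IsPrefilter φ w S)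
    (lam : ℝ) (hlam : lam ∈ S) :
    -- the localization space lies in `L²(ℝ)` and the integral defining its norm converges
    (∀ h ∈ locSpace φ, MemLp h 2 (volume : Measure ℝ) ∧
      IntegrableOn (fun ξ : ℝ => ‖fourierL2 h ξ‖ ^ 2 * (‖fourierL2 φ ξ‖ ^ 2)⁻¹)
        (Function.support (fourierL2 φ))) ∧
    -- the interpolating function is well defined, has the prescribed Fourier transform,
    -- and belongs to the reconstruction subspace
    (∀ᵐ ξ : ℝ, Summable (fun n : ℤ =>
        fourierL2 (autocorr φ) (ξ + n * (2 * Real.pi / lam))) ∧ interpDenom φ lam ξ ≠ 0) ∧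
    Integrable (interpHat φ lam) ∧
    fourierL2 (interp φ lam) =ᵐ[volume] interpHat φ lam ∧
    interp φ lam ∈ recSpace φ lam ∧
    -- the series in the error bound converges
    Summable (fun n : ℕ => 1 / w ((2 * (n + 1 : ℝ) - 1) * Real.pi / lam)) ∧
    -- the sampling theorem
    ∀ g ∈ locSpace φ, ∃ gt ∈ recSpace φ lam,
      Tendsto (fun s : Finset ℤ => locNorm φ (partialSeries φ lam g s - gt)) atTop (𝓝 0) ∧
      TendstoUniformly (partialSeries φ lam g) gt atTop ∧
      (∀ n : ℤ, gt (n * lam) = g (n * lam)) ∧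
      (∀ x : ℝ, ‖g x - gt x‖ ^ 2 ≤
        8 * moment w φ * (∑' n : ℕ, 1 / w ((2 * (n + 1 : ℝ) - 1) * Real.pi / lam)) *
          locNorm φ g ^ 2) ∧
      (g ≠ 0 → 0 < locNorm φ g ∧ ∀ x : ℝ, (‖g x - gt x‖ / locNorm φ g) ^ 2 ≤
        8 * moment w φ * ∑' n : ℕ, 1 / w ((2 * (n + 1 : ℝ) - 1) * Real.pi / lam)) := by
  have hpos : 0 < lam := hφ.intervals_pos lam hlam
  have hT : Fact (0 < lam⁻¹) := ⟨inv_pos.2 hpos⟩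
  have hR := hφ.riesz lam hlam
  obtain ⟨K, hK⟩ := exists_norm_fourier_le hR
  obtain ⟨ψ, hψ⟩ := exists_dualGenerator hR
  have hψV : ∀ n : ℤ, GenSampling.translate (n * lam) ψ ∈ shiftSpace φ lam := fun n =>
    (hψ.translate n).mem_shiftSpace
      ((fourier (-n)).continuous.measurable.mul measurable_dualMultiplier)
  have hsum := summable_one_div_weight hpos hφ.weight_pos hφ.weight_growth
  have : CompleteSpace (shiftSpace φ lam) :=
    (Submodule.isClosed_topologicalClosure _).completeSpace_coe
  refine ⟨?_, ?_, integrable_interpHat hR hψ, ?_, ?_, hsum, ?_⟩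
  · rintro _ ⟨f, rfl⟩
    exact ⟨(fourierL2_prefilter hK f).1, integrableOn_locSpace hK f⟩
  · exact (summable_and_interpDenom_eq hR).mono fun ξ h => ⟨h.1, h.2.2⟩
  · rw [interp_eq_prefilter hR hψ]
    exact (fourierL2_prefilter hK ψ).2.trans (interpHat_ae_eq hR hψ).symm
  · rw [interp_eq_prefilter hR hψ]
    exact prefilter_mem_recSpace hK (hψ.mem_shiftSpace measurable_dualMultiplier)
  rintro _ ⟨f₀, rfl⟩
  -- The preimage of equal norm makes bounds in `‖f‖` into bounds in the localization norm.
  obtain ⟨f, hf, hfn⟩ := exists_prefilter_eq_norm_eq hK f₀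
  rw [← hf] at hfn ⊢
  rw [← hfn]
  set Pf := (shiftSpace φ lam).starProjection f with hPf
  have hexp : HasSum (fun n : ℤ =>
      inner ℂ (GenSampling.translate (n * lam) φ) f • GenSampling.translate (n * lam) ψ)
      Pf :=
    hR.hasSum_starProjection hψV (inner_translate_dualGenerator hR hψ) f
  have hlim : Tendsto (fun s : Finset ℤ => ‖(∑ n ∈ s,
      inner ℂ (GenSampling.translate (n * lam) φ) f • GenSampling.translate (n * lam) ψ) - Pf‖)
      atTop (𝓝 0) :=
    tendsto_iff_norm_sub_tendsto_zero.1 hexp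
  have hdiff : ∀ s : Finset ℤ, partialSeries φ lam (prefilter φ f) s - prefilter φ Pf =
      prefilter φ ((∑ n ∈ s,
        inner ℂ (GenSampling.translate (n * lam) φ) f • GenSampling.translate (n * lam) ψ) - Pf) :=
      fun s => by
    rw [partialSeries_eq_prefilter hR hψ, ← prefilterₗ_apply, ← prefilterₗ_apply, ← map_sub,
      prefilterₗ_apply]
  have hM : 0 ≤ moment w φ := by
    rw [moment_eq_integral]
    refine integral_nonneg_of_ae ?_
    have hne : ∀ᵐ η : ℝ, η ≠ 0 := by simp [ae_iff]
    filter_upwards [hne] with η hη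
    have := hφ.weight_pos (2 * Real.pi * |η|) (by positivity)
    exact mul_nonneg this.le (by positivity)
  have hterm : ∀ n : ℕ, 0 ≤ 1 / w ((2 * (n + 1 : ℝ) - 1) * Real.pi / lam) := fun n => by
    refine one_div_nonneg.2 (hφ.weight_pos _ ?_).le
    have : (0 : ℝ) < 2 * (n + 1 : ℝ) - 1 := by linarith [n.cast_nonneg (α := ℝ)]
    positivity
  -- Index 0 gives the frequency `π/λ`; the remaining terms are only nonnegative slack.
  have hfirst : 1 / w (Real.pi / lam) ≤
      ∑' n : ℕ, 1 / w ((2 * (n + 1 : ℝ) - 1) * Real.pi / lam) := by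
    have := hsum.le_tsum 0 fun n _ => hterm n
    norm_num at this ⊢
    exact this
  have herr : ∀ x : ℝ, ‖prefilter φ f x - prefilter φ Pf x‖ ^ 2 ≤
      8 * moment w φ * (∑' n : ℕ, 1 / w ((2 * (n + 1 : ℝ) - 1) * Real.pi / lam)) * ‖f‖ ^ 2 :=
    fun x => by
    refine (norm_prefilter_sub_starProjection_sq_le (lam := lam) hφ.weight_pos hφ.weight_mono
      hφ.moment_finite f x).trans ?_
    have h0 : 0 ≤ 1 / w (Real.pi / lam) :=
      one_div_nonneg.2 (hφ.weight_pos _ (by positivity)).le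
    gcongr
    norm_num
  refine ⟨prefilter φ Pf, prefilter_mem_recSpace hK (Submodule.starProjection_apply_mem _ f),
    ?_, ?_, fun n => ?_, herr, fun hg => ?_⟩
  · refine squeeze_zero (fun s => Real.sqrt_nonneg _) (fun s => ?_) hlim
    rw [hdiff]
    exact locNorm_prefilter_le hK _
  · rw [Metric.tendstoUniformly_iff]
    intro ε hε
    have h1 := (hlim.const_mul ‖φ‖)
    rw [mul_zero] at h1
    filter_upwards [h1.eventually (gt_mem_nhds hε)] with s hs x
    rw [dist_comm, dist_eq_norm, ← Pi.sub_apply, hdiff]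
    exact (norm_prefilter_le φ _ x).trans_lt hs
  -- Interpolation: the residual is orthogonal to each translate that computes a sample.
  · have h1 : inner ℂ (f - Pf) (GenSampling.translate (n * lam) φ) = 0 :=
      Submodule.starProjection_inner_eq_zero _ _
        (Submodule.le_topologicalClosure _ (Submodule.subset_span ⟨n, rfl⟩))
    rw [inner_eq_zero_symm, inner_sub_right, sub_eq_zero] at h1
    rw [prefilter_eq_inner, prefilter_eq_inner, h1]
  · have hfpos : 0 < ‖f‖ := by
      refine norm_pos_iff.2 fun h0 => hg ?_
      rw [h0, ← prefilterₗ_apply, map_zero]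
    refine ⟨hfpos, fun x => ?_⟩
    rw [div_pow, div_le_iff₀ (by positivity)]
    exact herr x
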